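/- Let $P=\{p_1,\dots,p_n\}$ be a set of $n$ points on a line. A range assignment is a function $\rho:P\to\mathbb{R}_{\ge 0}$; it induces the directed communication graph $G_\rho=(P,E)$ with $E=\{(p,q): |pq|\le\rho(p)\}$. The interference of $p\in P$ is $RI(p)=|\{q\in P\setminus\{p\}: |pq|\le\rho(q)\}|$, and the total interference of $G_\rho$ is $I(G_\rho)=\sum_{p\in P}RI(p)$. Theorem. There is an algorithm which, given the coordinates of any set $P$ of $n$ points on a line (in arbitrary order), computes in $O(n^3)$ time a range assignment $\rho$ such that $G_\rho$ is strongly connected and $I(G_\rho)$ is minimum among all range assignments whose communication graph is strongly connected. Here time is the number of steps of one fixed program, the same for all $n$ and all inputs, on a real RAM: a random access machine with unit-cost exact arithmetic ($+,-,\times,/$) and comparisons on real numbers, no rounding and no conversion of reals to integers, and unit-cost addition, truncated subtraction, multiplication, comparison and array indexing on nonnegative integers of $O(\log n)$ bits. -/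

import Mathlib

open scoped NNReal

/-! ### Range assignments, communication graphs and interference -/

namespace Interference

variable {ι X : Type*} [MetricSpace X]

/-- A range assignment gives every point a nonnegative transmission range. The points are
indexed by `ι`, their positions are given by an injective map `p : ι → X`. -/
abbrev RangeAssignment (ι : Type*) := ι → ℝ≥0

/-- The directed communication graph: there is an edge from `u` to `v` iff `v` lies within the
transmission range of `u`. -/
def commGraph (p : ι → X) (ρ : RangeAssignment ι) : Digraph ι where
  Adj u v := dist (p u) (p v) ≤ ρ u

/-- Every vertex can be reached from every vertex by a directed path. -/
def StronglyConnected (G : Digraph ι) : Prop :=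
  ∀ u v : ι, Relation.ReflTransGen G.Adj u v

/-- A range assignment is valid if its communication graph is strongly connected. -/
def Valid (p : ι → X) (ρ : RangeAssignment ι) : Prop :=
  StronglyConnected (commGraph p ρ)

variable [Fintype ι] [DecidableEq ι]

/-- Receiver-centric interference of `u`: the number of other points whose range covers `u`. -/
noncomputable def RI (p : ι → X) (ρ : RangeAssignment ι) (u : ι) : ℕ :=
  (Finset.univ.filter fun v : ι => v ≠ u ∧ dist (p u) (p v) ≤ ρ v).card

/-- Sender-centric interference of `u`: the number of other points within the range of `u`. -/
noncomputable def SI (p : ι → X) (ρ : RangeAssignment ι) (u : ι) : ℕ :=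
  (Finset.univ.filter fun v : ι => v ≠ u ∧ dist (p u) (p v) ≤ ρ u).card

/-- Total interference of the communication graph. -/
noncomputable def total (p : ι → X) (ρ : RangeAssignment ι) : ℕ :=
  ∑ u, RI p ρ u

/-- The total interference can be computed on the receiver side or on the sender side. -/
theorem total_eq_sum_SI (p : ι → X) (ρ : RangeAssignment ι) : total p ρ = ∑ u, SI p ρ u := by
  simp only [total, RI, SI, Finset.card_filter]
  rw [Finset.sum_comm]
  refine Finset.sum_congr rfl fun u _ => Finset.sum_congr rfl fun v _ => ?_
  simp only [dist_comm (p u) (p v), ne_comm (a := u)]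

/-- `ρ` solves the minimum total interference problem for `p`: it is valid, and its total
interference is minimum among all valid range assignments. -/
def IsOptimal (p : ι → X) (ρ : RangeAssignment ι) : Prop :=
  Valid p ρ ∧ ∀ ρ' : RangeAssignment ι, Valid p ρ' → total p ρ ≤ total p ρ'

end Interference

/-! ### A real RAM with a step count

Programs manipulate arrays of machine integers and arrays of real numbers. A scalar variable is
cell `0` of an array. The operations on integers are `+`, truncated `-`, `*` and comparison; the
operations on reals are `+`, `-`, `*`, `/` and comparison, all exact. There is no rounding and no
conversion from reals to integers. All integers occurring in a computation must be smaller than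
a bound `B` (the word size of the machine is `log₂ B` bits); a program that exceeds the bound, or
divides by zero, is stuck and has no execution. -/

namespace RealRAM

/-- A memory: `int a i` and `real a i` are the contents of cell `i` of the `a`-th integer array
and of the `a`-th real array. -/
structure Mem where
  int : ℕ → ℕ → ℕ
  real : ℕ → ℕ → ℝ

namespace Mem

/-- Overwrite one integer cell. -/
def setInt (m : Mem) (a i v : ℕ) : Mem :=
  { m with int := Function.update m.int a (Function.update (m.int a) i v) }

/-- Overwrite one real cell. -/
noncomputable def setReal (m : Mem) (a i : ℕ) (v : ℝ) : Mem :=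
  { m with real := Function.update m.real a (Function.update (m.real a) i v) }

end Mem

/-- Integer expressions. `read a i` is the content of cell `i` of integer array `a`. -/
inductive IntExpr where
  | const (k : ℕ)
  | read (a : ℕ) (i : IntExpr)
  | add (e f : IntExpr)
  | sub (e f : IntExpr)
  | mul (e f : IntExpr)

namespace IntExpr

/-- Value of an integer expression. -/
def eval (m : Mem) : IntExpr → ℕ
  | const k => k
  | read a i => m.int a (i.eval m)
  | add e f => e.eval m + f.eval m
  | sub e f => e.eval m - f.eval m
  | mul e f => e.eval m * f.eval m

/-- Every value that occurs in the evaluation fits into a machine word. -/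
def Safe (B : ℕ) (m : Mem) : IntExpr → Prop
  | const k => k < B
  | read a i => i.Safe B m ∧ m.int a (i.eval m) < B
  | add e f => e.Safe B m ∧ f.Safe B m ∧ e.eval m + f.eval m < B
  | sub e f => e.Safe B m ∧ f.Safe B m
  | mul e f => e.Safe B m ∧ f.Safe B m ∧ e.eval m * f.eval m < B

/-- Number of constants, memory accesses and arithmetic operations. -/
def cost : IntExpr → ℕ
  | const _ => 1
  | read _ i => i.cost + 1
  | add e f => e.cost + f.cost + 1
  | sub e f => e.cost + f.cost + 1
  | mul e f => e.cost + f.cost + 1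

end IntExpr

/-- Real expressions. `read a i` is the content of cell `i` of real array `a`. -/
inductive RealExpr where
  | const (k : ℕ)
  | read (a : ℕ) (i : IntExpr)
  | add (e f : RealExpr)
  | sub (e f : RealExpr)
  | mul (e f : RealExpr)
  | div (e f : RealExpr)

namespace RealExpr

/-- Value of a real expression. -/
noncomputable def eval (m : Mem) : RealExpr → ℝ
  | const k => k
  | read a i => m.real a (i.eval m)
  | add e f => e.eval m + f.eval m
  | sub e f => e.eval m - f.eval m
  | mul e f => e.eval m * f.eval m
  | div e f => e.eval m / f.eval m

/-- All indices fit into a machine word, and there is no division by zero. -/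
def Safe (B : ℕ) (m : Mem) : RealExpr → Prop
  | const _ => True
  | read _ i => i.Safe B m
  | add e f => e.Safe B m ∧ f.Safe B m
  | sub e f => e.Safe B m ∧ f.Safe B m
  | mul e f => e.Safe B m ∧ f.Safe B m
  | div e f => e.Safe B m ∧ f.Safe B m ∧ f.eval m ≠ 0

/-- Number of constants, memory accesses and arithmetic operations. -/
def cost : RealExpr → ℕ
  | const _ => 1
  | read _ i => i.cost + 1
  | add e f => e.cost + f.cost + 1
  | sub e f => e.cost + f.cost + 1
  | mul e f => e.cost + f.cost + 1
  | div e f => e.cost + f.cost + 1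

end RealExpr

/-- Tests: comparisons of two integers or of two reals, and their Boolean combinations. -/
inductive Test where
  | intLt (e f : IntExpr)
  | realLt (e f : RealExpr)
  | not (b : Test)
  | and (b c : Test)

namespace Test

/-- The test succeeds. -/
def Holds (m : Mem) : Test → Prop
  | intLt e f => e.eval m < f.eval m
  | realLt e f => e.eval m < f.eval m
  | not b => ¬ b.Holds m
  | and b c => b.Holds m ∧ c.Holds m

/-- All expressions in the test can be evaluated. -/
def Safe (B : ℕ) (m : Mem) : Test → Prop
  | intLt e f => e.Safe B m ∧ f.Safe B m
  | realLt e f => e.Safe B m ∧ f.Safe B m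
  | not b => b.Safe B m
  | and b c => b.Safe B m ∧ c.Safe B m

/-- Number of elementary operations. -/
def cost : Test → ℕ
  | intLt e f => e.cost + f.cost + 1
  | realLt e f => e.cost + f.cost + 1
  | not b => b.cost + 1
  | and b c => b.cost + c.cost + 1

end Test

/-- Programs. `setInt a i e` stores the value of `e` in cell `i` of integer array `a`, and
`setReal a i e` does the same for the real array `a`. -/
inductive Prog where
  | skip
  | setInt (a : ℕ) (i e : IntExpr)
  | setReal (a : ℕ) (i : IntExpr) (e : RealExpr)
  | seq (P Q : Prog)
  | ite (b : Test) (P Q : Prog)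
  | loop (b : Test) (P : Prog)

/-- `Exec B P m t m'`: started in memory `m` on a machine with integer bound `B`, the program `P`
terminates after exactly `t` elementary steps with memory `m'`. The program `loop b P` repeats
`P` as long as the test `b` succeeds. -/
inductive Exec (B : ℕ) : Prog → Mem → ℕ → Mem → Prop where
  | skip (m : Mem) : Exec B .skip m 1 m
  | setInt (m : Mem) (a : ℕ) (i e : IntExpr) (hi : i.Safe B m) (he : e.Safe B m) :
      Exec B (.setInt a i e) m (i.cost + e.cost + 1) (m.setInt a (i.eval m) (e.eval m))
  | setReal (m : Mem) (a : ℕ) (i : IntExpr) (e : RealExpr) (hi : i.Safe B m) (he : e.Safe B m) :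
      Exec B (.setReal a i e) m (i.cost + e.cost + 1) (m.setReal a (i.eval m) (e.eval m))
  | seq {P Q : Prog} {m m' m'' : Mem} {s t : ℕ} (hP : Exec B P m s m') (hQ : Exec B Q m' t m'') :
      Exec B (.seq P Q) m (s + t) m''
  | ite_true {b : Test} {P Q : Prog} {m m' : Mem} {t : ℕ} (hs : b.Safe B m) (hb : b.Holds m)
      (hP : Exec B P m t m') : Exec B (.ite b P Q) m (b.cost + 1 + t) m'
  | ite_false {b : Test} {P Q : Prog} {m m' : Mem} {t : ℕ} (hs : b.Safe B m) (hb : ¬ b.Holds m)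
      (hQ : Exec B Q m t m') : Exec B (.ite b P Q) m (b.cost + 1 + t) m'
  | loop_false {b : Test} {P : Prog} {m : Mem} (hs : b.Safe B m) (hb : ¬ b.Holds m) :
      Exec B (.loop b P) m (b.cost + 1) m
  | loop_true {b : Test} {P : Prog} {m m' m'' : Mem} {s t : ℕ} (hs : b.Safe B m) (hb : b.Holds m)
      (hP : Exec B P m s m') (hl : Exec B (.loop b P) m' t m'') :
      Exec B (.loop b P) m (b.cost + 1 + s + t) m''

/-- The machine is deterministic: running time and final memory are determined by the program
and the initial memory. -/
theorem Exec.det {B : ℕ} {P : Prog} {m m₁ m₂ : Mem} {t₁ t₂ : ℕ} (h₁ : Exec B P m t₁ m₁)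
    (h₂ : Exec B P m t₂ m₂) : t₁ = t₂ ∧ m₁ = m₂ := by
  induction h₁ generalizing t₂ m₂ with
  | skip | setInt | setReal => cases h₂; exact ⟨rfl, rfl⟩
  | seq _ _ ihP ihQ =>
    cases h₂ with
    | seq hP' hQ' =>
      obtain ⟨rfl, rfl⟩ := ihP hP'
      obtain ⟨rfl, rfl⟩ := ihQ hQ'
      exact ⟨rfl, rfl⟩
  | ite_true _ hb _ ih =>
    cases h₂ with
    | ite_true _ _ h => obtain ⟨rfl, rfl⟩ := ih h; exact ⟨rfl, rfl⟩
    | ite_false _ hb' _ => exact absurd hb hb'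
  | ite_false _ hb _ ih =>
    cases h₂ with
    | ite_true _ hb' _ => exact absurd hb' hb
    | ite_false _ _ h => obtain ⟨rfl, rfl⟩ := ih h; exact ⟨rfl, rfl⟩
  | loop_false _ hb =>
    cases h₂ with
    | loop_false => exact ⟨rfl, rfl⟩
    | loop_true _ hb' _ _ => exact absurd hb' hb
  | loop_true _ hb _ _ ihP ihl =>
    cases h₂ with
    | loop_false _ hb' => exact absurd hb hb'
    | loop_true _ _ hP' hl' =>
      obtain ⟨rfl, rfl⟩ := ihP hP'
      obtain ⟨rfl, rfl⟩ := ihl hl'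
      exact ⟨rfl, rfl⟩

/-- The initial memory for an input of `n` reals: `n` is in cell `0` of integer array `0`, the
reals are in the first `n` cells of real array `0`, and all other cells contain `0`. -/
noncomputable def inputMem (n : ℕ) (x : Fin n → ℝ) : Mem where
  int a i := if a = 0 ∧ i = 0 then n else 0
  real a i := if h : a = 0 ∧ i < n then x ⟨i, h.2⟩ else 0

/-- `Outputs m n y`: the first `n` cells of real array `1` contain the sequence `y`. -/
def Outputs (m : Mem) (n : ℕ) (y : Fin n → ℝ) : Prop :=
  ∀ i : Fin n, m.real 1 i = y i

end RealRAM

/-! Counting covered pairs at the sender instead of the receiver turns total interference into a sum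
of one cost per point: the number of points its range covers. After sorting, let `c u v` be the cost
at `u` of a range that covers `v`. The task is to choose budgets `κ u` of minimum sum such that the
arcs `u → v` with `c u v ≤ κ u` form a strongly connected graph.

On a line `c u ·` grows on either side of `u`, so an arc also covers every point it passes over.
Hence `0` reaches `n - 1` along an increasing path and `n - 1` reaches `0` along a decreasing one.
Conversely, if both paths exist and every point reaches `0` or `n - 1`, the graph is strongly
connected. A point between two given points only needs to escape to one of them; this is the
subproblem `gap`. For the rest, both paths are swept from left to right. The state of the sweep is
the current vertex of each path together with the arcs still to be paid for: `up`, `down` and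
`both`.

`Step.solves` shows that a step assembles a solution from smaller ones; budgets are combined by
pointwise maximum, so costs at most add up. `value_le` is the converse bound: any feasible `κ` can
be followed through the steps, each point being charged once. A vertex used by both paths pays the
maximum of its two costs. `IsTable.optimal` combines the two bounds, and `isOptimal_of_sorted`
translates back to ranges.

Every step involves at most three indices, so there are `O(n ^ 2)` subproblems with `O(n)`
candidates each. A full budget vector is stored with each subproblem and merged in time `O(n)`, so
no backtracking is needed. Sorting by ranks takes `O(n ^ 2)` steps and the cost matrix `O(n ^ 3)`.
`runs_solveProg` gives the linear time per subproblem; `Context.step_of_gives` and `gives_of_step`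
identify the candidates of the program with the steps of the recursion. -/

namespace Interference

/-! ### Cost matrices on a line and monotone paths -/

/-- A cost matrix on `0, …, n - 1`: `c u v` is the cost of a range of `u` that covers `v`. It grows
with the distance on either side of `u`. -/
structure LineCost (n : ℕ) (c : ℕ → ℕ → ℕ) : Prop where
  self : ∀ u < n, c u u = 0
  right : ∀ u v w, u ≤ v → v ≤ w → w < n → c u v ≤ c u w
  left : ∀ u v w, w ≤ v → v ≤ u → u < n → c u v ≤ c u w

/-- Spending `κ u` at `u` creates an arc from `u` to `v`. -/
def Link (n : ℕ) (c : ℕ → ℕ → ℕ) (κ : ℕ → ℕ) (u v : ℕ) : Prop :=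
  u < n ∧ v < n ∧ c u v ≤ κ u

/-- There is a directed path from `u` to `v`. -/
def Reach (n : ℕ) (c : ℕ → ℕ → ℕ) (κ : ℕ → ℕ) : ℕ → ℕ → Prop :=
  Relation.ReflTransGen (Link n c κ)

/-- The arcs created by `κ` form a strongly connected graph. -/
def Feasible (n : ℕ) (c : ℕ → ℕ → ℕ) (κ : ℕ → ℕ) : Prop :=
  ∀ u v, u < n → v < n → Reach n c κ u v

section

variable {n : ℕ} {c : ℕ → ℕ → ℕ} {κ κ' : ℕ → ℕ}

theorem Reach.mono (h : ∀ i < n, κ i ≤ κ' i) {u v : ℕ} (huv : Reach n c κ u v) :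
    Reach n c κ' u v :=
  Relation.ReflTransGen.mono (fun a _ hab => ⟨hab.1, hab.2.1, hab.2.2.trans (h a hab.1)⟩) _ _ huv

theorem Reach.trans {u v w : ℕ} (h : Reach n c κ u v) (h' : Reach n c κ v w) :
    Reach n c κ u w :=
  Relation.ReflTransGen.trans h h'

theorem Link.reach {u v : ℕ} (h : Link n c κ u v) : Reach n c κ u v :=
  Relation.ReflTransGen.single h

/-- What `0` reaches is an initial segment, and it is reached along increasing paths. -/
theorem LineCost.increasing_path (hc : LineCost n c) {k : ℕ} (h : Reach n c κ 0 k) :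
    ∀ j ≤ k, Relation.ReflTransGen (fun a b => a < b ∧ Link n c κ a b) 0 j := by
  induction h with
  | refl => intro j hj; obtain rfl : j = 0 := by omega
            exact .refl
  | @tail a b _ hab ih =>
    intro j hj
    rcases le_or_gt j a with hja | hja
    · exact ih j hja
    · exact (ih a le_rfl).tail ⟨hja, hab.1, by have := hab.2.1; omega,
        (hc.right a j b hja.le hj hab.2.1).trans hab.2.2⟩

/-- Mirror image of `LineCost.increasing_path`: an arc that passes over `j` can be shortened to end
at `j`, because the cost decreases towards the sender. -/
theorem LineCost.decreasing_path (hc : LineCost n c) {k : ℕ} (h : Reach n c κ (n - 1) k) :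
    ∀ j < n, k ≤ j → Relation.ReflTransGen (fun a b => b < a ∧ Link n c κ a b) (n - 1) j := by
  induction h with
  | refl => intro j hj hj'; obtain rfl : j = n - 1 := by omega
            exact .refl
  | @tail a b _ hab ih =>
    intro j hj hbj
    rcases le_or_gt a j with hja | hja
    · exact ih j hj hja
    · exact (ih a hab.1 le_rfl).tail ⟨hja, hab.1, hj, (hc.left a j b hbj hja.le hab.1).trans hab.2.2⟩

theorem LineCost.reach_of_le (hc : LineCost n c) {k j : ℕ} (h : Reach n c κ 0 k) (hj : j ≤ k) :
    Reach n c κ 0 j :=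
  Relation.ReflTransGen.mono (fun _ _ hab => hab.2) _ _ (hc.increasing_path h j hj)

/-- For the points strictly between two given ones, this yields a point that pays for leaving the
interval; the bound on `gap` splits there. -/
theorem Reach.exists_exit {p : ℕ → Prop} {a b : ℕ} (h : Reach n c κ a b) (ha : p a) (hb : ¬ p b) :
    ∃ u v, p u ∧ ¬ p v ∧ Link n c κ u v := by
  induction h with
  | refl => exact absurd ha hb
  | @tail u v _ huv ih =>
    by_cases hu : p u
    · exact ⟨u, v, hu, hb, huv⟩
    · exact ih hu

end

/-! ### Subproblems and the steps that combine them -/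

/-- The subproblems of the dynamic program. `gap x y` concerns the points strictly between `x`
and `y`; the other three concern initial segments, cut where an increasing path from the first
point to the last one and a decreasing path back are to be continued. -/
inductive State where
  | zero
  | gap (x y : ℕ)
  | up (v s : ℕ)
  | down (u s : ℕ)
  | both (s t : ℕ)

namespace State

/-- What a solution of a subproblem achieves. -/
def Solves (n : ℕ) (c : ℕ → ℕ → ℕ) (κ : ℕ → ℕ) : State → Prop
  | zero => True
  | gap x y => ∀ w, x < w → w < y → Reach n c κ w x ∨ Reach n c κ w y
  | up v s => Reach n c κ 0 s ∧ Reach n c κ v 0 ∧ ∀ w < s, Reach n c κ w 0 ∨ Reach n c κ w s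
  | down u s => Reach n c κ 0 u ∧ Reach n c κ s 0 ∧
      ∀ w ≤ s, w ≠ u → Reach n c κ w 0 ∨ Reach n c κ w u
  | both s t => Reach n c κ 0 t ∧ Reach n c κ s 0 ∧ ∀ w ≤ s, Reach n c κ w 0 ∨ Reach n c κ w t

/-- `Step n c τ σ₁ σ₂ u w`: a solution of `τ` is obtained from solutions of `σ₁` and `σ₂` by
spending `w` at `u`. -/
inductive Step (n : ℕ) (c : ℕ → ℕ → ℕ) : State → State → State → ℕ → ℕ → Prop
  | gap_succ {x : ℕ} (h : x + 1 < n) : Step n c (gap x (x + 1)) zero zero (x + 1) 0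
  | gap_split {x u y : ℕ} (hxu : x < u) (huy : u < y) (hy : y < n) :
      Step n c (gap x y) (gap x u) (gap u y) u (min (c u x) (c u y))
  | up_of_both {v s : ℕ} (hvs : v < s) (hs : s < n) :
      Step n c (up v s) (both v s) (gap v s) s 0
  | up_of_up {v u s : ℕ} (hvu : v < u) (hus : u < s) (hs : s < n) :
      Step n c (up v s) (up v u) (gap u s) u (c u s)
  -- Here `s` pays for its arc back to `v` while `u` is still unpaid; `both_of_down` then pays for
  -- `u`. Doing both at once would involve four indices and cost a factor `n` in time.
  | down_of_up {v u s : ℕ} (hvu : v < u) (hus : u < s) (hs : s < n) :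
      Step n c (down u s) (up v u) (gap u s) s (c s v)
  | both_zero {t : ℕ} (ht : t < n) : Step n c (both 0 t) zero zero 0 (c 0 t)
  | both_of_down {u s t : ℕ} (hus : u < s) (hst : s ≤ t) (ht : t < n) :
      Step n c (both s t) (down u s) zero u (c u t)
  | both_of_up {v s t : ℕ} (hvs : v < s) (hst : s ≤ t) (ht : t < n) :
      Step n c (both s t) (up v s) zero s (max (c s v) (c s t))
  | both_of_both {v s t : ℕ} (hvs : v < s) (hst : s ≤ t) (ht : t < n) :
      Step n c (both s t) (both v t) (gap v s) s (c s v)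

/-- The subproblems are numbered in the order in which they are solved. -/
def id (n : ℕ) : State → ℕ
  | zero => 0
  -- The order is by right end (or sweep position), then by type, then by a parameter below `n`. For
  -- gaps this parameter is the number of interior points, so `gap u y` precedes `gap x y` when `x <
  -- u`. The shift by one reserves `0` for `zero`.
  | gap x y => (4 * y + 0) * n + (y - 1 - x) + 1
  | up v s => (4 * s + 1) * n + v + 1
  | down u s => (4 * s + 2) * n + u + 1
  | both s t => (4 * s + 3) * n + (t - s) + 1

theorem mul_add_lt_mul_add {n a b x y : ℕ} (h : a < b) (hx : x < n) : a * n + x + 1 < b * n + y + 1 := by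
  have : (a + 1) * n ≤ b * n := Nat.mul_le_mul_right n h
  rw [Nat.add_mul] at this
  omega

variable {n : ℕ} {c : ℕ → ℕ → ℕ} {τ σ₁ σ₂ : State} {u w : ℕ}

/-- A single pass in numerical order therefore finds all sources of a step already solved. -/
theorem Step.id_lt (h : Step n c τ σ₁ σ₂ u w) : σ₁.id n < τ.id n ∧ σ₂.id n < τ.id n ∧ u < n := by
  cases h <;> simp only [id] <;> refine ⟨?_, ?_, by omega⟩ <;>
    first
      | exact mul_add_lt_mul_add (by omega) (by omega)
      | exact Nat.succ_pos _
      | omega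

/-- Enlarging budgets preserves reachability, so `κ` inherits every path of `κ₁` and `κ₂`; the
supports need not be disjoint. The amount `w` at `u` supplies the new arcs, and each point follows
an old path to an end, then possibly a new arc. -/
theorem Step.solves (h : Step n c τ σ₁ σ₂ u w) {κ₁ κ₂ κ : ℕ → ℕ}
    (h₁ : σ₁.Solves n c κ₁) (h₂ : σ₂.Solves n c κ₂) (hκ₁ : ∀ i < n, κ₁ i ≤ κ i)
    (hκ₂ : ∀ i < n, κ₂ i ≤ κ i) (hw : w ≤ κ u) : τ.Solves n c κ := by
  have m₁ : ∀ {a b}, Reach n c κ₁ a b → Reach n c κ a b := fun h => h.mono hκ₁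
  have m₂ : ∀ {a b}, Reach n c κ₂ a b → Reach n c κ a b := fun h => h.mono hκ₂
  have link : ∀ {v}, u < n → v < n → c u v ≤ w → Reach n c κ u v := fun hu hv h =>
    Link.reach ⟨hu, hv, h.trans hw⟩
  cases h with
  | gap_succ h => intro w h1 h2; omega
  | @gap_split x u y hxu huy hy =>
    have hu : Reach n c κ u x ∨ Reach n c κ u y := by
      rcases min_choice (c u x) (c u y) with h | h
      · exact .inl (link (by omega) (by omega) h.ge)
      · exact .inr (link (by omega) (by omega) h.ge)
    intro z h1 h2
    rcases lt_trichotomy z u with hz | rfl | hz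
    · rcases h₁ z h1 hz with h | h
      · exact .inl (m₁ h)
      · exact hu.imp (m₁ h).trans (m₁ h).trans
    · exact hu
    · rcases h₂ z hz h2 with h | h
      · exact hu.imp (m₂ h).trans (m₂ h).trans
      · exact .inr (m₂ h)
  | @up_of_both v s hvs hs =>
    obtain ⟨a, b, d⟩ := h₁
    refine ⟨m₁ a, m₁ b, fun z hz => ?_⟩
    rcases le_or_gt z v with h | h
    · exact (d z h).imp m₁ m₁
    · exact (h₂ z h hz).imp (fun h => (m₂ h).trans (m₁ b)) m₂
  | @up_of_up v u s hvu hus hs =>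
    obtain ⟨a, b, d⟩ := h₁
    have l := link (v := s) (by omega) hs le_rfl
    refine ⟨(m₁ a).trans l, m₁ b, fun z hz => ?_⟩
    rcases lt_trichotomy z u with h | rfl | h
    · exact (d z h).imp m₁ fun h => (m₁ h).trans l
    · exact .inr l
    · exact (h₂ z h hz).elim (fun h => .inr ((m₂ h).trans l)) fun h => .inr (m₂ h)
  | @down_of_up v u s hvu hus hs =>
    obtain ⟨a, b, d⟩ := h₁
    have l := (link (v := v) hs (by omega) le_rfl).trans (m₁ b)
    refine ⟨m₁ a, l, fun z hz hzu => ?_⟩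
    rcases hzu.lt_or_gt with h | h
    · exact (d z h).imp m₁ m₁
    · rcases hz.lt_or_eq with hz | rfl
      · exact (h₂ z h hz).elim (fun h => .inr (m₂ h)) fun h => .inl ((m₂ h).trans l)
      · exact .inl l
  | @both_zero t ht =>
    refine ⟨link (by omega) ht le_rfl, .refl, fun z hz => .inl ?_⟩
    obtain rfl : z = 0 := by omega
    exact .refl
  | @both_of_down u s t hus hst ht =>
    obtain ⟨a, b, d⟩ := h₁
    have l := link (v := t) (by omega) ht le_rfl
    refine ⟨(m₁ a).trans l, m₁ b, fun z hz => ?_⟩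
    by_cases h : z = u
    · subst h; exact .inr l
    · exact (d z hz h).imp m₁ fun h => (m₁ h).trans l
  | @both_of_up v s t hvs hst ht =>
    obtain ⟨a, b, d⟩ := h₁
    have l := link (v := t) (by omega) ht (le_max_right _ _)
    have l' := (link (v := v) (by omega) (by omega) (le_max_left _ _)).trans (m₁ b)
    refine ⟨(m₁ a).trans l, l', fun z hz => ?_⟩
    rcases hz.lt_or_eq with hz | rfl
    · exact (d z hz).imp m₁ fun h => (m₁ h).trans l
    · exact .inl l'
  | @both_of_both v s t hvs hst ht =>
    obtain ⟨a, b, d⟩ := h₁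
    have l := (link (v := v) (by omega) (by omega) le_rfl).trans (m₁ b)
    refine ⟨m₁ a, l, fun z hz => ?_⟩
    rcases le_or_gt z v with h | h
    · exact (d z h).imp m₁ m₁
    · rcases hz.lt_or_eq with hz | rfl
      · exact (h₂ z h hz).elim (fun h => .inl ((m₂ h).trans (m₁ b))) fun h => .inl ((m₂ h).trans l)
      · exact .inl l

/-! ### Lower bound: following a feasible solution through the steps -/

/-- The value of the last subproblem bounds the cost of every feasible solution from below. -/
theorem value_le (hc : LineCost n c) {V : State → ℕ} (h0 : V zero = 0)
    (hV : ∀ τ σ₁ σ₂ u w, Step n c τ σ₁ σ₂ u w → V τ ≤ V σ₁ + V σ₂ + w) {κ : ℕ → ℕ} (hn : 0 < n)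
    (hκ : Feasible n c κ) : V (both (n - 1) (n - 1)) ≤ ∑ i ∈ Finset.range n, κ i := by
  set S : ℕ → ℕ := fun k => ∑ i ∈ Finset.range k, κ i with hS
  have hS1 : ∀ k, S (k + 1) = S k + κ k := fun k => Finset.sum_range_succ _ _
  change _ ≤ S n
  -- `S y - S (x + 1)` is exactly what `κ` spends strictly between `x` and `y`.
  have hgap : ∀ d x y, y - x = d → x < y → y < n → V (gap x y) + S (x + 1) ≤ S y := by
    intro d
    induction d using Nat.strong_induction_on with
    | _ d ih =>
      intro x y hd hxy hy
      rcases Nat.eq_or_lt_of_le (Nat.succ_le_of_lt hxy) with h | h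
      · subst h
        have := hV _ _ _ _ _ (Step.gap_succ (c := c) hy)
        simp only [Nat.succ_eq_add_one] at *
        omega
      -- A path from `x + 1` to `x` must leave the open interval. The arc that does so, from `u`,
      -- covers `x` or `y`, so `κ u` pays for the split at `u`.
      · obtain ⟨u, v, ⟨hxu, huy⟩, hv, huv⟩ := (hκ (x + 1) x (by omega) (by omega)).exists_exit
          (p := fun z => x < z ∧ z < y) ⟨by omega, h⟩ (by omega)
        have hu := huv.1
        have hv' := huv.2.1
        have hmin : min (c u x) (c u y) ≤ κ u := by
          rcases le_or_gt v x with h' | h'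
          · exact (min_le_left _ _).trans ((hc.left u x v h' hxu.le hu).trans huv.2.2)
          · exact (min_le_right _ _).trans ((hc.right u y v huy.le (by omega) hv').trans huv.2.2)
        have := hV _ _ _ _ _ (Step.gap_split (c := c) hxu huy hy)
        have := ih (u - x) (by omega) x u rfl hxu hu
        have := ih (y - u) (by omega) u y rfl huy hy
        have := hS1 u
        omega
  replace hgap := fun x y => hgap _ x y rfl
  set R := Relation.ReflTransGen fun a b => a < b ∧ Link n c κ a b with hR
  set R' := Relation.ReflTransGen fun a b => b < a ∧ Link n c κ a b with hR'
  -- The increasing path is unrolled from its source and the decreasing path from its target, so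
  -- both are discovered from left to right.
  have hRn : ∀ u, R u (n - 1) → u = n - 1 ∨ ∃ u', u < u' ∧ Link n c κ u u' ∧ R u' (n - 1) := by
    intro u hu
    rcases Relation.ReflTransGen.cases_head hu with h | ⟨u', ⟨h1, h2⟩, h3⟩
    · exact .inl h
    · exact .inr ⟨u', h1, h2, h3⟩
  have hRn' : ∀ v, R' (n - 1) v → v = n - 1 ∨ ∃ t, v < t ∧ Link n c κ t v ∧ R' (n - 1) t := by
    intro u hu
    rcases Relation.ReflTransGen.cases_tail hu with h | ⟨u', h3, ⟨h1, h2⟩⟩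
    · exact .inl h
    · exact .inr ⟨u', h1, h2, h3⟩
  have hn1 : n - 1 + 1 = n := by omega
  -- Invariants of the sweep, with `v` the current vertex of the decreasing path. In `up v u` the
  -- points before `u` are charged and the arc into `v` comes from some `t ≥ u`; in `both v t` the
  -- points up to `v` are charged and the increasing path has already jumped ahead to `t`.
  have main : ∀ d v, n - v = d →
      (∀ u t, v < u → u ≤ t → t < n → Link n c κ t v → R u (n - 1) → R' (n - 1) t →
        V (up v u) ≤ S u → V (both (n - 1) (n - 1)) ≤ S n) ∧
      ∀ t, v < t → t < n → R t (n - 1) → R' (n - 1) v → V (both v t) ≤ S (v + 1) →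
        V (both (n - 1) (n - 1)) ≤ S n := by
    intro d
    induction d using Nat.strong_induction_on with
    | _ d ih =>
      intro v hd
      have hup : ∀ e u t, n - u = e → v < u → u ≤ t → t < n → Link n c κ t v → R u (n - 1) →
          R' (n - 1) t → V (up v u) ≤ S u → V (both (n - 1) (n - 1)) ≤ S n := by
        intro e
        induction e using Nat.strong_induction_on with
        | _ e ihe =>
          intro u t he hvu hut ht htv hu hpt hval
          rcases hut.eq_or_lt with rfl | hut
          -- The two paths meet at `u`: a single payment covers both its arc back to `v` and its arc
          -- forward. At `u = n - 1` there is no forward arc and the sweep ends.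
          · rcases hRn u hu with rfl | ⟨u', huu', hl, hu'⟩
            · have h1 := hV _ _ _ _ _ (Step.both_of_up (c := c) hvu le_rfl ht)
              have h2 := hS1 (n - 1)
              have h3 := htv.2.2
              have h4 : c (n - 1) (n - 1) ≤ c (n - 1) v := hc.left _ _ _ (by omega) le_rfl ht
              rw [max_eq_left h4] at h1
              rw [hn1] at h2
              omega
            · refine (ih (n - u) (by omega) u rfl).2 u' huu' hl.2.1 hu' hpt ?_
              have h1 := hV _ _ _ _ _ (Step.both_of_up (c := c) hvu huu'.le hl.2.1)
              have h2 := hS1 u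
              have h3 : max (c u v) (c u u') ≤ κ u := max_le htv.2.2 hl.2.2
              omega
          · rcases hRn u hu with rfl | ⟨u', huu', hl, hu'⟩
            · omega
            have h2 := hS1 u
            have h3 := hl.2.2
            have h5 := htv.2.2
            rcases le_or_gt u' t with h | h
            · refine ihe (n - u') (by omega) u' t rfl (by omega) h ht htv hu' hpt ?_
              have h1 := hV _ _ _ _ _ (Step.up_of_up (c := c) hvu huu' hl.2.1)
              have h4 := hgap u u' huu' hl.2.1
              omega
            -- The increasing arc jumps from `u` over `t`. First `t` is charged for its arc to `v`
            -- (`down`), then `u` for its arc to `u'`, which leads to `both t u'`.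
            · refine (ih (n - t) (by omega) t rfl).2 u' h hl.2.1 hu' hpt ?_
              have h1 := hV _ _ _ _ _ (Step.down_of_up (c := c) hvu hut ht)
              have h4 := hgap u t hut ht
              have h6 := hV _ _ _ _ _ (Step.both_of_down (c := c) hut h.le hl.2.1)
              have h7 := hS1 t
              omega
      refine ⟨fun u t => hup _ u t rfl, fun t hvt ht hu hpv hval => ?_⟩
      rcases hRn' v hpv with rfl | ⟨s, hvs, hl, hps⟩
      · omega
      have h5 := hl.2.2
      -- The decreasing arc into `v` starts at `s`. If `s < t`, the decreasing path advances below
      -- the increasing one. Otherwise no path vertex lies strictly between `v` and `t`, and a gap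
      -- completes the prefix to `up v t`.
      rcases lt_or_ge s t with h | h
      · refine (ih (n - s) (by omega) s rfl).2 t h ht hu hps ?_
        have h1 := hV _ _ _ _ _ (Step.both_of_both (c := c) hvs h.le ht)
        have h4 := hgap v s hvs hl.1
        have h7 := hS1 s
        omega
      · refine hup _ t s rfl hvt h hl.1 hl hu hps ?_
        have h1 := hV _ _ _ _ _ (Step.up_of_both (c := c) hvt ht)
        have h4 := hgap v t hvt ht
        omega
  have hR0 : R 0 (n - 1) := hc.increasing_path (hκ 0 (n - 1) hn (by omega)) _ le_rfl
  have hR0' : R' (n - 1) 0 := hc.decreasing_path (hκ (n - 1) 0 (by omega) hn) 0 hn le_rfl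
  rcases hRn 0 hR0 with h | ⟨t, h1, h2, h3⟩
  -- A single point: nothing has to be paid.
  · have h6 := hV _ _ _ _ _ (Step.both_zero (c := c) hn)
    obtain rfl : n = 1 := by omega
    rw [h0, hc.self 0 hn] at h6
    exact h6.trans (Nat.zero_le _)
  · refine (main _ 0 rfl).2 t h1 h2.2.1 h3 hR0' ?_
    have h6 := hV _ _ _ _ _ (Step.both_zero (c := c) h2.2.1)
    have := hS1 0
    have := h2.2.2
    omega

/-- The parameters of a subproblem are in range. -/
def Valid (n : ℕ) : State → Prop
  | zero => True
  | gap x y => x < y ∧ y < n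
  | up v s => v < s ∧ s < n
  | down u s => u < s ∧ s < n
  | both s t => s ≤ t ∧ t < n

theorem Step.valid {n : ℕ} {c : ℕ → ℕ → ℕ} {τ σ₁ σ₂ : State} {u w : ℕ}
    (h : Step n c τ σ₁ σ₂ u w) : τ.Valid n ∧ σ₁.Valid n ∧ σ₂.Valid n := by
  cases h <;> simp only [Valid, and_true] <;> omega

end State

/-! ### Tables of solutions -/

open State

/-- A table of solutions of all subproblems: `V` contains their costs, and `K` the solutions. -/
structure IsTable (n : ℕ) (c : ℕ → ℕ → ℕ) (M : ℕ) (V : ℕ → ℕ) (K : ℕ → ℕ → ℕ) : Prop where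
  V_zero : V 0 = 0
  K_zero : ∀ i < n, K 0 i = 0
  le : ∀ τ σ₁ σ₂ u w, Step n c τ σ₁ σ₂ u w → V (τ.id n) ≤ V (σ₁.id n) + V (σ₂.id n) + w
  attained : ∀ τ : State, τ.Valid n → τ ≠ zero → M ≤ V (τ.id n) ∨
    ∃ σ₁ σ₂ u w, Step n c τ σ₁ σ₂ u w ∧ V (τ.id n) = V (σ₁.id n) + V (σ₂.id n) + w ∧
      ∀ i < n, K (τ.id n) i = max (max (K (σ₁.id n) i) (K (σ₂.id n) i)) (if i = u then w else 0)

namespace IsTable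

variable {n M : ℕ} {c : ℕ → ℕ → ℕ} {V : ℕ → ℕ} {K : ℕ → ℕ → ℕ}

/-- Induction along the numbering. A value below `M` rules out the infinite alternative, and then
both sources also have values below `M`. The stored vector is a maximum of three vectors, so its sum
is at most the sum of their totals. -/
theorem solves (h : IsTable n c M V K) : ∀ τ : State, τ.Valid n → V (τ.id n) < M →
    τ.Solves n c (K (τ.id n)) ∧ ∑ i ∈ Finset.range n, K (τ.id n) i ≤ V (τ.id n) := by
  suffices H : ∀ N, ∀ τ : State, τ.id n = N → τ.Valid n → V (τ.id n) < M →
      τ.Solves n c (K (τ.id n)) ∧ ∑ i ∈ Finset.range n, K (τ.id n) i ≤ V (τ.id n) from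
    fun τ => H _ τ rfl
  intro N
  induction N using Nat.strong_induction_on with
  | _ N ih =>
    intro τ hτ hv hM
    by_cases h0 : τ = zero
    · subst h0
      change True ∧ ∑ i ∈ Finset.range n, K 0 i ≤ V 0
      refine ⟨trivial, ?_⟩
      rw [Finset.sum_eq_zero fun i hi => h.K_zero i (Finset.mem_range.1 hi)]
      exact Nat.zero_le _
    rcases h.attained τ hv h0 with hle | ⟨σ₁, σ₂, u, w, hs, hV, hK⟩
    · omega
    obtain ⟨i₁, i₂, hu⟩ := hs.id_lt
    obtain ⟨-, v₁, v₂⟩ := hs.valid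
    obtain ⟨s₁, c₁⟩ := ih _ (hτ ▸ i₁) σ₁ rfl v₁ (by omega)
    obtain ⟨s₂, c₂⟩ := ih _ (hτ ▸ i₂) σ₂ rfl v₂ (by omega)
    constructor
    · refine hs.solves s₁ s₂ (fun i hi => ?_) (fun i hi => ?_) ?_
      · rw [hK i hi]; exact (le_max_left _ _).trans (le_max_left _ _)
      · rw [hK i hi]; exact (le_max_right _ _).trans (le_max_left _ _)
      · rw [hK u hu, if_pos rfl]; exact le_max_right _ _
    · calc ∑ i ∈ Finset.range n, K (τ.id n) i
          ≤ ∑ i ∈ Finset.range n, (K (σ₁.id n) i + K (σ₂.id n) i + if i = u then w else 0) := by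
            refine Finset.sum_le_sum fun i hi => ?_
            rw [hK i (Finset.mem_range.1 hi)]
            omega
        _ = ∑ i ∈ Finset.range n, K (σ₁.id n) i + ∑ i ∈ Finset.range n, K (σ₂.id n) i + w := by
            rw [Finset.sum_add_distrib, Finset.sum_add_distrib, Finset.sum_ite_eq' ]
            simp [hu]
        _ ≤ V (τ.id n) := by omega

/-- The entry for the last subproblem of a table is an optimal solution. -/
theorem optimal (h : IsTable n c M V K) (hc : LineCost n c) (hn : 0 < n)
    (hcn : ∀ i < n, ∀ j < n, c i j ≤ n) (hM : n * n < M) :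
    Feasible n c (K ((both (n - 1) (n - 1)).id n)) ∧ ∀ κ, Feasible n c κ →
      ∑ i ∈ Finset.range n, K ((both (n - 1) (n - 1)).id n) i ≤ ∑ i ∈ Finset.range n, κ i := by
  have hle : ∀ κ, Feasible n c κ →
      V ((both (n - 1) (n - 1)).id n) ≤ ∑ i ∈ Finset.range n, κ i := fun κ hκ =>
    value_le hc (V := fun τ => V (τ.id n)) h.V_zero h.le hn hκ
  -- The constant budget `n` makes every arc available, so the optimum is at most `n * n` and lies
  -- below infinity.
  have hlt : V ((both (n - 1) (n - 1)).id n) < M := by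
    refine (hle (fun _ => n) fun u v hu hv => Link.reach ⟨hu, hv, hcn u hu v hv⟩).trans_lt ?_
    simpa using hM
  obtain ⟨⟨h1, h2, h3⟩, hsum⟩ := h.solves (both (n - 1) (n - 1)) ⟨le_rfl, by omega⟩ hlt
  -- Every point reaches `0`, directly or through `n - 1`, and `0` reaches all points since it
  -- reaches the last one.
  refine ⟨fun u v hu hv => ?_, fun κ hκ => hsum.trans (hle κ hκ)⟩
  have hu0 := (h3 u (by omega)).elim (fun h => h) fun h => h.trans h2
  exact hu0.trans (hc.reach_of_le h1 (by omega))

end IsTable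

/-! ### From ranges on the line to cost matrices and back -/

/-- The number of points, other than point `i`, that are at most as far from point `i` as
point `j`, for points with positions `y 0, …, y (n - 1)`. -/
noncomputable def coverCount (n : ℕ) (y : ℕ → ℝ) (i j : ℕ) : ℕ :=
  ((Finset.range n).filter fun k =>
    (y k - y i) * (y k - y i) ≤ (y j - y i) * (y j - y i) ∧ 0 < (y k - y i) * (y k - y i)).card

theorem coverCount_le (n : ℕ) (y : ℕ → ℝ) (i j : ℕ) : coverCount n y i j ≤ n :=
  (Finset.card_filter_le _ _).trans (Finset.card_range n).le

theorem coverCount_mono {n : ℕ} {y : ℕ → ℝ} {i j j' : ℕ} (h : |y j - y i| ≤ |y j' - y i|) :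
    coverCount n y i j ≤ coverCount n y i j' := by
  refine Finset.card_le_card fun k => ?_
  simp only [Finset.mem_filter]
  exact fun ⟨h1, h2, h3⟩ => ⟨h1, h2.trans (abs_le_iff_mul_self_le.1 h), h3⟩

theorem lineCost_coverCount {n : ℕ} {y : ℕ → ℝ} (hy : ∀ i j, i < j → j < n → y i < y j) :
    LineCost n (coverCount n y) := by
  have hy' : ∀ i j, i ≤ j → j < n → y i ≤ y j := fun i j hij hj =>
    hij.eq_or_lt.elim (fun h => by rw [h]) fun h => (hy i j h hj).le
  refine ⟨fun u _ => ?_, fun u v w huv hvw hw => coverCount_mono ?_,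
    fun u v w hwv hvu hu => coverCount_mono ?_⟩
  · rw [coverCount, Finset.card_eq_zero, Finset.filter_eq_empty_iff]
    rintro k - ⟨h1, h2⟩
    rw [sub_self, mul_zero] at h1
    exact h1.not_gt h2
  · have h1 := hy' u v huv (by omega)
    have h2 := hy' v w hvw hw
    rw [abs_of_nonneg (by linarith), abs_of_nonneg (by linarith)]
    linarith
  · have h1 := hy' w v hwv (by omega)
    have h2 := hy' v u hvu hu
    rw [abs_of_nonpos (by linarith), abs_of_nonpos (by linarith)]
    linarith

/-- Optimal costs for the sorted sequence of positions give an optimal range assignment. -/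
theorem isOptimal_of_sorted {n : ℕ} {x : Fin n → ℝ} (hx : Function.Injective x) (e : Fin n ≃ Fin n)
    {y : ℕ → ℝ} (hy : ∀ i, y (e i) = x i) {κ : ℕ → ℕ} (hκ : Feasible n (coverCount n y) κ)
    (hmin : ∀ κ', Feasible n (coverCount n y) κ' →
      ∑ i ∈ Finset.range n, κ i ≤ ∑ i ∈ Finset.range n, κ' i)
    {ρ : RangeAssignment (Fin n)}
    (hρ : ∀ i, ∀ j < n, coverCount n y (e i) j ≤ κ (e i) → |y j - y (e i)| ≤ ρ i)
    (hρ' : ∀ i, (ρ i : ℝ) = 0 ∨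
      ∃ j < n, coverCount n y (e i) j ≤ κ (e i) ∧ (ρ i : ℝ) = |y j - y (e i)|) :
    IsOptimal x ρ := by
  have hdist : ∀ u v, dist (x u) (x v) = |y (e v) - y (e u)| := fun u v => by
    rw [hy, hy, dist_comm, Real.dist_eq]
  have hlt : ∀ {k}, k < n → ∃ v, (e v : ℕ) = k := fun {k} hk => ⟨e.symm ⟨k, hk⟩, by simp⟩
  have hsum : ∀ κ : ℕ → ℕ, ∑ i ∈ Finset.range n, κ i = ∑ u, κ (e u) := fun κ => by
    rw [Finset.sum_range]
    exact (Equiv.sum_comp e fun k : Fin n => κ k).symm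
  constructor
  · intro u v
    have H : ∀ b, Reach n (coverCount n y) κ (e u) b → ∀ v, (e v : ℕ) = b →
        Relation.ReflTransGen (commGraph x ρ).Adj u v := by
      intro b hb
      induction hb with
      | refl => intro v hv
                rw [e.injective (Fin.ext hv)]
      | @tail a b _ hab ih =>
        intro v hv
        obtain ⟨z, hz⟩ := hlt hab.1
        refine (ih z hz).tail ?_
        subst hz hv
        change dist (x z) (x v) ≤ ρ z
        rw [hdist]
        exact hρ z _ hab.2.1 hab.2.2
    exact H _ (hκ _ _ (e u).2 (e v).2) v rfl
  · intro ρ' hV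
    rw [total_eq_sum_SI, total_eq_sum_SI]
    -- A competing range assignment is turned into budgets by spending at each point its
    -- sender-centric interference. The value outside `0, …, n - 1` plays no role.
    set κ' : ℕ → ℕ := fun k => if h : k < n then SI x ρ' (e.symm ⟨k, h⟩) else 0 with hκ'
    have hκe : ∀ u, κ' (e u) = SI x ρ' u := fun u => by simp [hκ']
    have hfeas : Feasible n (coverCount n y) κ' := by
      intro a b ha hb
      obtain ⟨u, rfl⟩ := hlt ha
      obtain ⟨v, rfl⟩ := hlt hb
      refine Relation.ReflTransGen.lift (fun z => (e z : ℕ)) (fun u v huv => ?_) _ _ (hV u v)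
      refine ⟨(e u).2, (e v).2, ?_⟩
      rw [hκe]
      change dist (x u) (x v) ≤ ρ' u at huv
      rw [hdist] at huv
      refine (Finset.card_le_card (t := Finset.image (fun z => (e z : ℕ)) (Finset.univ.filter
        fun z => z ≠ u ∧ dist (x u) (x z) ≤ ρ' u)) fun k => ?_).trans Finset.card_image_le
      simp only [Finset.mem_filter, Finset.mem_range, Finset.mem_image, Finset.mem_univ, true_and]
      rintro ⟨h1, h2, h3⟩
      obtain ⟨z, rfl⟩ := hlt h1
      refine ⟨z, ⟨?_, ?_⟩, rfl⟩
      · rintro rfl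
        simp at h3
      · rw [hdist]
        exact (abs_le_iff_mul_self_le.2 h2).trans huv
    refine le_trans ?_ ((hmin κ' hfeas).trans ?_)
    · rw [hsum]
      refine Finset.sum_le_sum fun u _ => ?_
      -- A zero range covers no other point. A range that ends exactly at the `j`-th sorted point
      -- covers at most `coverCount n y (e u) j` others, which is within budget.
      rcases hρ' u with h0 | ⟨j, hj, hjκ, hρj⟩
      · have : SI x ρ u = 0 := by
          rw [SI, Finset.card_eq_zero, Finset.filter_eq_empty_iff]
          rintro v - ⟨h1, h2⟩
          rw [h0] at h2
          exact h1 (hx (dist_le_zero.1 h2)).symm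
        rw [this]
        exact Nat.zero_le _
      · refine le_trans ?_ hjκ
        rw [SI, coverCount]
        refine Finset.card_le_card_of_injOn (fun z => (e z : ℕ)) (fun z => ?_)
          fun a _ b _ hab => e.injective (Fin.ext hab)
        simp only [Finset.coe_filter, Finset.mem_univ, true_and, Set.mem_ofPred_eq,
          Finset.mem_range]
        rintro ⟨h1, h2⟩
        rw [hdist, hρj] at h2
        refine ⟨(e z).2, abs_le_iff_mul_self_le.1 h2, mul_self_pos.2 (sub_ne_zero.2 fun h => ?_)⟩
        rw [hy, hy] at h
        exact h1 (hx h)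
    · rw [hsum]
      exact (Finset.sum_congr rfl fun u _ => hκe u).le

end Interference

/-! ### Memory updates, word size and rules for running time -/

namespace RealRAM

namespace Mem

theorem setInt_int (m : Mem) (a i v b j : ℕ) :
    (m.setInt a i v).int b j = if b = a ∧ j = i then v else m.int b j := by
  by_cases hb : b = a
  · subst hb
    by_cases hj : j = i <;> simp [setInt, hj]
  · simp [setInt, hb]

theorem setInt_int_of_ne (m : Mem) {a b : ℕ} (i v : ℕ) (h : b ≠ a) :
    (m.setInt a i v).int b = m.int b := by
  simp [setInt, h]

theorem setInt_int_self (m : Mem) (a i v : ℕ) : (m.setInt a i v).int a i = v := by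
  simp [setInt]

@[simp] theorem setInt_real (m : Mem) (a i v : ℕ) : (m.setInt a i v).real = m.real := rfl

@[simp] theorem setReal_int (m : Mem) (a i : ℕ) (v : ℝ) : (m.setReal a i v).int = m.int := rfl

theorem setReal_real (m : Mem) (a i : ℕ) (v : ℝ) (b j : ℕ) :
    (m.setReal a i v).real b j = if b = a ∧ j = i then v else m.real b j := by
  by_cases hb : b = a
  · subst hb
    by_cases hj : j = i <;> simp [setReal, hj]
  · simp [setReal, hb]

theorem setReal_real_of_ne (m : Mem) {a b : ℕ} (i : ℕ) (v : ℝ) (h : b ≠ a) :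
    (m.setReal a i v).real b = m.real b := by
  simp [setReal, h]

theorem setInt_same (m : Mem) (a i : ℕ) : m.setInt a i (m.int a i) = m := by
  simp [setInt]

theorem setInt_setInt (m : Mem) (a i v w : ℕ) : (m.setInt a i v).setInt a i w = m.setInt a i w := by
  simp [setInt]

theorem setInt_comm (m : Mem) {a b : ℕ} (i j v w : ℕ) (h : a ≠ b) :
    (m.setInt a i v).setInt b j w = (m.setInt b j w).setInt a i v := by
  simp [setInt, h, h.symm, Function.update_comm h]

/-- All integer cells contain at most `L`. -/
def Bounded (L : ℕ) (m : Mem) : Prop := ∀ a i, m.int a i ≤ L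

theorem Bounded.setInt {L : ℕ} {m : Mem} (hm : m.Bounded L) {a i v : ℕ} (hv : v ≤ L) :
    (m.setInt a i v).Bounded L := by
  intro b j
  rw [setInt_int]
  split_ifs
  exacts [hv, hm b j]

theorem Bounded.setReal {L : ℕ} {m : Mem} (hm : m.Bounded L) {a i : ℕ} {v : ℝ} :
    (m.setReal a i v).Bounded L := hm

end Mem

/-- The weight of an integer expression: its value is at most `L` to the power of its weight if all
memory cells contain at most `L ≥ 2`. -/
def IntExpr.weight : IntExpr → ℕ
  | const k => k
  | read _ i => i.weight + 1
  | add e f => e.weight + f.weight + 1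
  | sub e f => e.weight + f.weight
  | mul e f => e.weight + f.weight

/-- All index expressions have weight at most `D`, and there are no divisions. -/
def RealExpr.Light (D : ℕ) : RealExpr → Prop
  | const _ => True
  | read _ i => i.weight ≤ D
  | add e f => e.Light D ∧ f.Light D
  | sub e f => e.Light D ∧ f.Light D
  | mul e f => e.Light D ∧ f.Light D
  | div _ _ => False

/-- All integer expressions in the test have weight at most `D`, and there are no divisions. -/
def Test.Light (D : ℕ) : Test → Prop
  | intLt e f => e.weight ≤ D ∧ f.weight ≤ D
  | realLt e f => e.Light D ∧ f.Light D
  | not b => b.Light D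
  | and b c => b.Light D ∧ c.Light D

/-- Expressions of weight at most `D` can be evaluated by a machine with integer bound `B` as long
as all memory cells contain at most `L`. -/
structure WordSize (L D B : ℕ) : Prop where
  two_le : 2 ≤ L
  pow_lt : L ^ D < B

/-- Running time of programs without loops. -/
def Prog.cost : Prog → ℕ
  | skip => 1
  | setInt _ i e => i.cost + e.cost + 1
  | setReal _ i e => i.cost + e.cost + 1
  | seq P Q => P.cost + Q.cost
  | ite b P Q => b.cost + 1 + max P.cost Q.cost
  | loop _ _ => 0

/-- Started in memory `m`, the program terminates after at most `T` steps with a memory that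
satisfies `Q`. -/
def Runs (B : ℕ) (P : Prog) (m : Mem) (T : ℕ) (Q : Mem → Prop) : Prop :=
  ∃ t m', Exec B P m t m' ∧ t ≤ T ∧ Q m'

section

variable {L D B : ℕ} {m : Mem}

/-- The extra unit of weight for a sum comes from `a + b ≤ 2 * a * b ≤ L * a * b` for `a, b ≥ 1`; a
constant satisfies `k < L ^ k`. -/
theorem IntExpr.eval_le (hL : 2 ≤ L) (hm : m.Bounded L) (e : IntExpr) :
    e.eval m ≤ L ^ e.weight := by
  have hpos : ∀ k, 1 ≤ L ^ k := fun k => Nat.one_le_pow _ _ (by omega)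
  induction e with
  | const k => exact (Nat.lt_pow_self hL).le
  | read a i _ =>
    refine (hm _ _).trans ?_
    rw [weight, pow_succ]
    exact Nat.le_mul_of_pos_left _ (hpos _)
  | add e f he hf =>
    simp only [eval, weight, pow_succ, pow_add]
    have h1 := Nat.le_mul_of_pos_right (L ^ e.weight) (hpos f.weight)
    have h2 := Nat.le_mul_of_pos_left (L ^ f.weight) (hpos e.weight)
    have h3 := Nat.mul_le_mul_left (L ^ e.weight * L ^ f.weight) hL
    omega
  | sub e f he hf =>
    refine (Nat.sub_le _ _).trans (he.trans ?_)
    exact Nat.pow_le_pow_right (by omega) (Nat.le_add_right _ _)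
  | mul e f he hf =>
    simp only [eval, weight, pow_add]
    exact Nat.mul_le_mul he hf

theorem IntExpr.safe (hB : WordSize L D B) (hm : m.Bounded L) {e : IntExpr} (he : e.weight ≤ D) :
    e.Safe B m := by
  have key : ∀ e : IntExpr, e.weight ≤ D → e.eval m < B := fun e he =>
    (e.eval_le hB.two_le hm).trans_lt
      ((Nat.pow_le_pow_right (by have := hB.two_le; omega) he).trans_lt hB.pow_lt)
  induction e with
  | const k => exact key (.const k) he
  | read a i ih => exact ⟨ih (by rw [weight] at he; omega), key (.read a i) he⟩
  | add e f ihe ihf =>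
    exact ⟨ihe (by rw [weight] at he; omega), ihf (by rw [weight] at he; omega), key _ he⟩
  | sub e f ihe ihf =>
    exact ⟨ihe (by rw [weight] at he; omega), ihf (by rw [weight] at he; omega)⟩
  | mul e f ihe ihf =>
    exact ⟨ihe (by rw [weight] at he; omega), ihf (by rw [weight] at he; omega), key _ he⟩

theorem RealExpr.safe (hB : WordSize L D B) (hm : m.Bounded L) {e : RealExpr} (he : e.Light D) :
    e.Safe B m := by
  induction e with
  | const k => trivial
  | read a i => exact IntExpr.safe hB hm he
  | add e f ihe ihf => exact ⟨ihe he.1, ihf he.2⟩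
  | sub e f ihe ihf => exact ⟨ihe he.1, ihf he.2⟩
  | mul e f ihe ihf => exact ⟨ihe he.1, ihf he.2⟩
  | div e f => exact he.elim

theorem Test.safe (hB : WordSize L D B) (hm : m.Bounded L) {b : Test} (hb : b.Light D) :
    b.Safe B m := by
  induction b with
  | intLt e f => exact ⟨IntExpr.safe hB hm hb.1, IntExpr.safe hB hm hb.2⟩
  | realLt e f => exact ⟨RealExpr.safe hB hm hb.1, RealExpr.safe hB hm hb.2⟩
  | not b ih => exact ih hb
  | and b c ihb ihc => exact ⟨ihb hb.1, ihc hb.2⟩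

namespace Runs

variable {P R : Prog} {T T₁ T₂ : ℕ} {Q Q' : Mem → Prop}

theorem mono (h : Runs B P m T Q) (hT : T ≤ T₁) (hQ : ∀ m', Q m' → Q' m') : Runs B P m T₁ Q' := by
  obtain ⟨t, m', h1, h2, h3⟩ := h
  exact ⟨t, m', h1, h2.trans hT, hQ m' h3⟩

theorem skip (hQ : Q m) : Runs B .skip m 1 Q := ⟨1, m, .skip m, le_rfl, hQ⟩

theorem setInt (hB : WordSize L D B) (hm : m.Bounded L) {a : ℕ} {i e : IntExpr}
    (hi : i.weight ≤ D) (he : e.weight ≤ D) (hQ : Q (m.setInt a (i.eval m) (e.eval m))) :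
    Runs B (.setInt a i e) m (i.cost + e.cost + 1) Q :=
  ⟨_, _, .setInt m a i e (IntExpr.safe hB hm hi) (IntExpr.safe hB hm he), le_rfl, hQ⟩

theorem setReal (hB : WordSize L D B) (hm : m.Bounded L) {a : ℕ} {i : IntExpr} {e : RealExpr}
    (hi : i.weight ≤ D) (he : e.Light D) (hQ : Q (m.setReal a (i.eval m) (e.eval m))) :
    Runs B (.setReal a i e) m (i.cost + e.cost + 1) Q :=
  ⟨_, _, .setReal m a i e (IntExpr.safe hB hm hi) (RealExpr.safe hB hm he), le_rfl, hQ⟩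

theorem seq (hP : Runs B P m T₁ fun m' => Runs B R m' T₂ Q) : Runs B (.seq P R) m (T₁ + T₂) Q := by
  obtain ⟨t, m', h1, h2, t', m'', h3, h4, h5⟩ := hP
  exact ⟨_, _, h1.seq h3, by omega, h5⟩

theorem ite (hB : WordSize L D B) (hm : m.Bounded L) {b : Test} (hb : b.Light D)
    (h₁ : b.Holds m → Runs B P m T₁ Q) (h₂ : ¬ b.Holds m → Runs B R m T₂ Q) :
    Runs B (.ite b P R) m (b.cost + 1 + max T₁ T₂) Q := by
  by_cases h : b.Holds m
  · obtain ⟨t, m', h3, h4, h5⟩ := h₁ h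
    exact ⟨_, _, .ite_true (Test.safe hB hm hb) h h3, by omega, h5⟩
  · obtain ⟨t, m', h3, h4, h5⟩ := h₂ h
    exact ⟨_, _, .ite_false (Test.safe hB hm hb) h h3, by omega, h5⟩

end Runs

/-- The scalar in cell `0` of an integer array. -/
abbrev var (a : ℕ) : IntExpr := .read a (.const 0)

/-- `for a := 0, …, hi - 1 do P`. -/
def forLoop (a : ℕ) (hi : IntExpr) (P : Prog) : Prog :=
  .seq (.setInt a (.const 0) (.const 0))
    (.loop (.intLt (var a) hi) (.seq P (.setInt a (.const 0) (.add (var a) (.const 1)))))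

/-- The invariant rule for counting loops. The limit `hi` is evaluated again at every test, so the
invariant must fix its value `N`; the body must leave the counter at `k` for the increment to be
right. One round costs the body, `hi.cost + 4` for the test and `6` for the increment. -/
theorem Runs.forLoop (hB : WordSize L D B) (hD : 3 ≤ D) (hm : m.Bounded L) {a N T : ℕ}
    {hi : IntExpr} {P : Prog} {Q : Mem → Prop} (I : ℕ → Mem → Prop) (hw : hi.weight ≤ D)
    (hI : ∀ k m, I k m → m.int a 0 = k ∧ m.Bounded L ∧ hi.eval m = N) (h0 : I 0 (m.setInt a 0 0))
    (hP : ∀ k < N, ∀ m, I k m →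
      Runs B P m T fun m' => m'.int a 0 = k ∧ m'.Bounded L ∧ I (k + 1) (m'.setInt a 0 (k + 1)))
    (hQ : ∀ m, I N m → Q m) :
    Runs B (forLoop a hi P) m (N * (T + hi.cost + 10) + hi.cost + 10) Q := by
  have main : ∀ d k, k + d = N → ∀ m, I k m →
      Runs B (.loop (.intLt (var a) hi) (.seq P (.setInt a (.const 0) (.add (var a) (.const 1))))) m
        (d * (T + hi.cost + 10) + hi.cost + 5) Q := by
    have htest : (Test.intLt (var a) hi).cost = hi.cost + 3 := by
      simp only [Test.cost, IntExpr.cost]; omega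
    intro d
    induction d with
    | zero =>
      intro k hk m hIk
      obtain ⟨h1, h2, h3⟩ := hI k m hIk
      refine ⟨_, m, .loop_false (Test.safe hB h2 ⟨?_, hw⟩) ?_, ?_, hQ m (by convert hIk; omega)⟩
      · exact (show 1 ≤ D by omega)
      · simp only [Test.Holds, IntExpr.eval, h1, h3]; omega
      · rw [htest]; omega
    | succ d ih =>
      intro k hk m hIk
      obtain ⟨h1, h2, h3⟩ := hI k m hIk
      obtain ⟨s, m₁, e₁, hs, k₁, b₁, i₁⟩ := hP k (by omega) m hIk
      obtain ⟨t, m₂, e₂, ht, q₂⟩ := ih (k + 1) (by omega) _ i₁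
      have e₃ : Exec B (.setInt a (.const 0) (.add (var a) (.const 1))) m₁ 6
          (m₁.setInt a 0 (k + 1)) := by
        have := Exec.setInt (B := B) m₁ a (.const 0) (.add (var a) (.const 1))
          (IntExpr.safe hB b₁ (Nat.zero_le _)) (IntExpr.safe hB b₁ ?_)
        · simpa [IntExpr.eval, IntExpr.cost, k₁] using this
        · exact hD
      refine ⟨_, m₂, .loop_true (Test.safe hB h2 ⟨show 1 ≤ D by omega, hw⟩) ?_ (e₁.seq e₃) e₂, ?_, q₂⟩
      · simp only [Test.Holds, IntExpr.eval, h1, h3]; omega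
      · rw [htest, Nat.succ_mul]; omega
  have e0 := Exec.setInt (B := B) m a (.const 0) (.const 0) (IntExpr.safe hB hm (Nat.zero_le _))
    (IntExpr.safe hB hm (Nat.zero_le _))
  obtain ⟨t, m', e, ht, hq⟩ := main N 0 (by omega) _ h0
  refine ⟨_, m', e0.seq e, ?_, hq⟩
  simp only [IntExpr.cost]
  omega

/-- Count the `k < hi` that pass the test. -/
def countLoop (v : ℕ) (hi : IntExpr) (b : Test) (a : ℕ) (i : IntExpr) : Prog :=
  forLoop v hi (.ite b (.setInt a i (.add (.read a i) (.const 1))) .skip)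

/-- Only the counter and the target cell change, so the whole memory is known in each round and can
serve as the invariant. -/
theorem Runs.countLoop (hB : WordSize L D B) (hm : m.Bounded L) {v a q N : ℕ}
    {hi i : IntExpr} {b : Test} {Q : Mem → Prop} (p : ℕ → Prop) [DecidablePred p] (hva : v ≠ a)
    (hw : hi.weight ≤ D) (hb : b.Light D) (hi' : i.weight + 3 ≤ D) (hN : m.int a q + N ≤ L)
    (h : ∀ k x, let m' := (m.setInt v 0 k).setInt a q x;
      hi.eval m' = N ∧ i.eval m' = q ∧ (k < N → (b.Holds m' ↔ p k)))
    (hQ : Q ((m.setInt v 0 N).setInt a q (m.int a q + ((Finset.range N).filter p).card))) :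
    Runs B (countLoop v hi b a i) m
      (N * (b.cost + (2 * i.cost + 5) + hi.cost + 10) + hi.cost + 10) Q := by
  have hcard : ∀ k, ((Finset.range k).filter p).card ≤ k := fun k =>
    (Finset.card_filter_le _ _).trans (Finset.card_range k).le
  refine (Runs.forLoop hB (by omega) hm (N := N) (fun k m' => k ≤ N ∧
    m' = (m.setInt v 0 k).setInt a q (m.int a q + ((Finset.range k).filter p).card))
    hw ?_ ?_ (T := b.cost + (2 * i.cost + 5)) ?_ fun m' hm' => hm'.2 ▸ hQ)
  · rintro k _ ⟨hk, rfl⟩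
    refine ⟨?_, (hm.setInt (by omega)).setInt (by have := hcard k; omega), (h k _).1⟩
    rw [Mem.setInt_int_of_ne _ _ _ hva, Mem.setInt_int_self]
  · refine ⟨Nat.zero_le _, ?_⟩
    rw [Mem.setInt_comm _ _ _ _ _ hva]
    simp [Mem.setInt_same]
  · rintro k hk _ ⟨-, rfl⟩
    set x := m.int a q + ((Finset.range k).filter p).card with hx
    obtain ⟨h1, h2, h3⟩ := h k x
    have hle := hcard k
    have hbd : ((m.setInt v 0 k).setInt a q x).Bounded L :=
      (hm.setInt (by omega)).setInt (by omega)
    have hv : ∀ x, ((m.setInt v 0 k).setInt a q x).int v 0 = k := fun x => by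
      rw [Mem.setInt_int_of_ne _ _ _ hva, Mem.setInt_int_self]
    have hnext : ∀ x, ((m.setInt v 0 k).setInt a q x).setInt v 0 (k + 1) =
        (m.setInt v 0 (k + 1)).setInt a q x := fun x => by
      rw [Mem.setInt_comm _ _ _ _ _ hva, Mem.setInt_setInt, Mem.setInt_comm _ _ _ _ _ hva.symm]
    refine (Runs.ite hB hbd hb (T₁ := i.cost + (i.cost + 1 + 1 + 1) + 1) (fun hbm => ?_)
      (fun hbm => Runs.skip ?_)).mono (by omega) fun _ h => h
    · refine Runs.setInt hB hbd (by omega) (by simp only [IntExpr.weight]; omega) ?_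
      simp only [IntExpr.eval, h2, Mem.setInt_int_self, Mem.setInt_setInt]
      refine ⟨hv _, (hm.setInt (by omega)).setInt (by omega), by omega, ?_⟩
      rw [hnext, Finset.range_add_one, Finset.filter_insert, if_pos ((h3 hk).1 hbm),
        Finset.card_insert_of_notMem (by simp)]
      rfl
    · refine ⟨hv _, hbd, by omega, ?_⟩
      rw [hnext, Finset.range_add_one, Finset.filter_insert, if_neg (mt (h3 hk).2 hbm)]

end

open Interference (coverCount coverCount_le)

/-! ### Sorting and the cost matrix -/

/-- Sort the reals in array `0` into array `2`; the ranks are stored in integer array `5`. -/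
def sortProg : Prog :=
  forLoop 1 (var 0) (.seq
    (countLoop 2 (var 0) (.realLt (.read 0 (var 2)) (.read 0 (var 1))) 5 (var 1))
    (.setReal 2 (.read 5 (var 1)) (.read 0 (var 1))))

/-- The number of entries of a sequence of length `n` that are smaller than entry `i`. -/
noncomputable def rank (n : ℕ) (X : ℕ → ℝ) (i : ℕ) : ℕ :=
  ((Finset.range n).filter fun j => X j < X i).card

/-- Entry `i` is counted for `j` but not for itself. Hence distinct reals get distinct ranks, and
ranks serve as sorted positions. -/
theorem rank_lt_rank {n : ℕ} {X : ℕ → ℝ} {i j : ℕ} (hi : i < n) (h : X i < X j) :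
    rank n X i < rank n X j := by
  refine Finset.card_lt_card ⟨fun k => ?_, fun hsub => ?_⟩
  · simp only [Finset.mem_filter]
    exact fun ⟨h1, h2⟩ => ⟨h1, h2.trans h⟩
  · have := hsub (Finset.mem_filter.2 ⟨Finset.mem_range.2 hi, h⟩)
    simp at this

theorem rank_lt {n : ℕ} {X : ℕ → ℝ} {i : ℕ} (hi : i < n) : rank n X i < n := by
  refine (Finset.card_lt_card (t := Finset.range n) ⟨Finset.filter_subset _ _, fun hsub => ?_⟩).trans_eq
    (Finset.card_range n)
  have := hsub (Finset.mem_range.2 hi)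
  simp at this

variable {L B : ℕ} {m : Mem}

theorem runs_sortProg (hB : WordSize L 100 B) (hm : m.Bounded L) {n : ℕ} (hn : m.int 0 0 = n)
    (hz : ∀ i < n, m.int 5 i = 0)
    (hinj : ∀ i < n, ∀ j < n, i ≠ j → m.real 0 i < m.real 0 j ∨ m.real 0 j < m.real 0 i) :
    Runs B sortProg m (n * (n * 31 + 34) + 12) fun m' =>
      m'.Bounded L ∧ (∀ b, b ≠ 1 → b ≠ 2 → b ≠ 5 → m'.int b = m.int b) ∧
      (∀ i < n, m'.int 5 i = rank n (m.real 0) i) ∧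
      (∀ b ≠ 2, m'.real b = m.real b) ∧
      ∀ i < n, m'.real 2 (rank n (m.real 0) i) = m.real 0 i := by
  have hnL : n ≤ L := hn ▸ hm 0 0
  refine (Runs.forLoop hB (by norm_num) hm (N := n) (T := n * 31 + 12 + 10)
    (fun i m' => i ≤ n ∧ m'.int 1 0 = i ∧ m'.Bounded L ∧
      (∀ b, b ≠ 1 → b ≠ 2 → b ≠ 5 → m'.int b = m.int b) ∧
      (∀ i' < n, m'.int 5 i' = if i' < i then rank n (m.real 0) i' else 0) ∧
      (∀ b ≠ 2, m'.real b = m.real b) ∧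
      ∀ i' < i, m'.real 2 (rank n (m.real 0) i') = m.real 0 i')
    (by simp [IntExpr.weight]) ?_ ?_ ?_ ?_).mono (by simp only [IntExpr.cost]; ring_nf; omega) fun _ h => h
  · rintro k m' ⟨-, h1, h2, h3, -⟩
    exact ⟨h1, h2, by simp [IntExpr.eval, h3 0, hn]⟩
  · refine ⟨Nat.zero_le _, Mem.setInt_int_self .., hm.setInt (Nat.zero_le _),
      fun b h1 _ _ => Mem.setInt_int_of_ne _ _ _ h1, fun i' hi' => ?_, fun _ _ => rfl, by simp⟩
    rw [Mem.setInt_int_of_ne _ _ _ (by norm_num)]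
    simp [hz i' hi']
  · rintro i hi m' ⟨-, h1, h2, h3, h4, h5, h6⟩
    have h50 : m'.int 5 i = 0 := by rw [h4 i hi]; simp
    refine (Runs.seq (Runs.countLoop hB h2 (v := 2) (a := 5) (q := i) (N := n)
      (fun j => m.real 0 j < m.real 0 i) (by norm_num) (by simp [IntExpr.weight])
      (by simp [Test.Light, RealExpr.Light, IntExpr.weight]) (by simp [IntExpr.weight])
      (by omega) ?_ (Runs.setReal hB ?_ (by simp [IntExpr.weight])
        (by simp [RealExpr.Light, IntExpr.weight]) ?_))).mono ?_ fun _ h => h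
    · intro k x
      refine ⟨?_, ?_, fun _ => ?_⟩
      · simp [IntExpr.eval, Mem.setInt_int, h3 0, hn]
      · simp [IntExpr.eval, Mem.setInt_int, h1]
      · simp [Test.Holds, RealExpr.eval, IntExpr.eval, Mem.setInt_int, h1, h5 0]
    · refine (h2.setInt hnL).setInt ?_
      rw [h50, zero_add]
      exact ((Finset.card_filter_le _ _).trans (Finset.card_range n).le).trans hnL
    · have hr : ((Finset.range n).filter fun j => m.real 0 j < m.real 0 i).card =
        rank n (m.real 0) i := rfl
      simp only [hr, h50, zero_add, IntExpr.eval, RealExpr.eval, Mem.setReal_int]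
      have hi1 : ((m'.setInt 2 0 n).setInt 5 i (rank n (m.real 0) i)).int 1 0 = i := by
        simp [Mem.setInt_int, h1]
      have hbd : ((m'.setInt 2 0 n).setInt 5 i (rank n (m.real 0) i)).Bounded L :=
        (h2.setInt hnL).setInt ((rank_lt hi).le.trans hnL)
      simp only [hi1, Mem.setInt_int_self, Mem.setInt_real]
      refine ⟨trivial, hbd.setReal, hi, trivial, hbd.setReal.setInt (by omega), fun b b1 b2 b5 => ?_,
        fun i' hi' => ?_, fun b hb => ?_, fun i' hi' => ?_⟩
      · rw [Mem.setInt_int_of_ne _ _ _ b1, Mem.setReal_int, Mem.setInt_int_of_ne _ _ _ b5,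
          Mem.setInt_int_of_ne _ _ _ b2, h3 b b1 b2 b5]
      · simp only [Mem.setInt_int, Mem.setReal_int]
        norm_num
        rcases lt_trichotomy i' i with h | rfl | h
        · rw [if_neg (by omega), if_pos (by omega), h4 i' hi', if_pos h]
        · simp
        · rw [if_neg (by omega), if_neg (by omega), h4 i' hi', if_neg (by omega)]
      · rw [Mem.setReal_real_of_ne _ _ _ hb, Mem.setInt_real, Mem.setInt_real, h5 b hb]
      · rw [Mem.setReal_real, h5 0 (by norm_num)]
        -- Distinctness of ranks ensures that the new write does not destroy an earlier one.
        rcases (Nat.le_of_lt_succ hi').lt_or_eq with h | rfl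
        · have : rank n (m.real 0) i' ≠ rank n (m.real 0) i := by
            rcases hinj i' (by omega) i hi h.ne with h' | h'
            · exact (rank_lt_rank (by omega) h').ne
            · exact (rank_lt_rank hi h').ne'
          simp [this, h6 i' h]
        · simp
    · simp only [Test.cost, RealExpr.cost, IntExpr.cost]
      ring_nf
      omega
  · rintro m' ⟨-, -, h2, h3, h4, h5, h6⟩
    refine ⟨h2, h3, fun i hi => ?_, h5, h6⟩
    rw [h4 i hi, if_pos hi]

/-- Square of the difference of two entries of real array `2`. -/
def sqDiff (i j : IntExpr) : RealExpr :=
  .mul (.sub (.read 2 i) (.read 2 j)) (.sub (.read 2 i) (.read 2 j))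

/-- Compute the costs of all ranges of the sorted points and store them in integer array `6`. -/
def costProg : Prog :=
  forLoop 1 (var 0) (forLoop 2 (var 0)
    (countLoop 3 (var 0)
      (.and (.not (.realLt (sqDiff (var 2) (var 1)) (sqDiff (var 3) (var 1))))
        (.realLt (.const 0) (sqDiff (var 3) (var 1))))
      6 (.add (.mul (var 1) (var 0)) (var 2))))

theorem mul_add_div_mod {n i j : ℕ} (hj : j < n) : (i * n + j) / n = i ∧ (i * n + j) % n = j := by
  have hn : 0 < n := by omega
  rw [Nat.add_comm, Nat.add_mul_div_right _ _ hn, Nat.add_mul_mod_self_right]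
  simp [Nat.div_eq_of_lt hj, Nat.mod_eq_of_lt hj]

theorem runs_costProg (hB : WordSize L 100 B) (hm : m.Bounded L) {n : ℕ} (hn : m.int 0 0 = n)
    (hz : ∀ i, m.int 6 i = 0) :
    Runs B costProg m (n * (n * (n * 83 + 24) + 24) + 12) fun m' =>
      m'.Bounded L ∧ (∀ b, b ≠ 1 → b ≠ 2 → b ≠ 3 → b ≠ 6 → m'.int b = m.int b) ∧
      (∀ i < n, ∀ j < n, m'.int 6 (i * n + j) = coverCount n (m.real 2) i j) ∧
      m'.real = m.real := by
  have hnL : n ≤ L := hn ▸ hm 0 0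
  -- The matrix is stored by rows, so a cell number determines its row and column, and the invariant
  -- only says how many cells are filled.
  set F : ℕ → ℕ := fun q => coverCount n (m.real 2) (q / n) (q % n) with hF
  refine (Runs.forLoop hB (by norm_num) hm (N := n) (T := n * (n * 83 + 24) + 12)
    (fun i m' => m'.int 1 0 = i ∧ m'.Bounded L ∧
      (∀ b, b ≠ 1 → b ≠ 2 → b ≠ 3 → b ≠ 6 → m'.int b = m.int b) ∧
      (∀ q, m'.int 6 q = if q < i * n then F q else 0) ∧ m'.real = m.real)
    (by simp [IntExpr.weight]) ?_ ?_ ?_ ?_).mono (by simp only [IntExpr.cost]; ring_nf; omega) fun _ h => h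
  · rintro k m' ⟨h1, h2, h3, -⟩
    exact ⟨h1, h2, by simp [IntExpr.eval, h3 0, hn]⟩
  · refine ⟨Mem.setInt_int_self .., hm.setInt (Nat.zero_le _),
      fun b h1 _ _ _ => Mem.setInt_int_of_ne _ _ _ h1, fun q => ?_, rfl⟩
    rw [Mem.setInt_int_of_ne _ _ _ (by norm_num)]
    simp [hz q]
  · rintro i hi m₁ ⟨h1, h2, h3, h4, h5⟩
    refine (Runs.forLoop hB (by norm_num) h2 (N := n) (T := n * 83 + 12)
      (fun j m' => m'.int 2 0 = j ∧ m'.Bounded L ∧ m'.int 1 0 = i ∧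
        (∀ b, b ≠ 1 → b ≠ 2 → b ≠ 3 → b ≠ 6 → m'.int b = m.int b) ∧
        (∀ q, m'.int 6 q = if q < i * n + j then F q else 0) ∧ m'.real = m.real)
      (by simp [IntExpr.weight]) ?_ ?_ ?_ ?_).mono
        (by simp only [IntExpr.cost]; ring_nf; omega) fun _ h => h
    · rintro k m' ⟨h1, h2, -, h3, -⟩
      exact ⟨h1, h2, by simp [IntExpr.eval, h3 0, hn]⟩
    · refine ⟨Mem.setInt_int_self .., h2.setInt (Nat.zero_le _), by simp [Mem.setInt_int, h1],
        fun b b1 b2 b3 b6 => ?_, fun q => ?_, h5⟩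
      · rw [Mem.setInt_int_of_ne _ _ _ b2, h3 b b1 b2 b3 b6]
      · rw [Mem.setInt_int_of_ne _ _ _ (by norm_num), h4, add_zero]
    · rintro j hj m₂ ⟨g1, g2, g3, g4, g5, g6⟩
      have h60 : m₂.int 6 (i * n + j) = 0 := by rw [g5]; simp
      refine (Runs.countLoop hB g2 (v := 3) (a := 6) (q := i * n + j) (N := n)
        (fun k => (m.real 2 k - m.real 2 i) * (m.real 2 k - m.real 2 i) ≤
            (m.real 2 j - m.real 2 i) * (m.real 2 j - m.real 2 i) ∧
          0 < (m.real 2 k - m.real 2 i) * (m.real 2 k - m.real 2 i)) (by norm_num)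
        (by simp [IntExpr.weight]) (by simp [Test.Light, RealExpr.Light, IntExpr.weight, sqDiff])
        (by simp [IntExpr.weight]) (by omega) ?_ ?_).mono ?_ fun _ h => h
      · intro k x
        refine ⟨?_, ?_, fun _ => ?_⟩
        · simp [IntExpr.eval, Mem.setInt_int, g4 0, hn]
        · simp [IntExpr.eval, Mem.setInt_int, g4 0, hn, g1, g3]
        · simp [Test.Holds, RealExpr.eval, IntExpr.eval, Mem.setInt_int, g1, g3, g6, sqDiff]
      · have hr : ∀ s : Finset ℕ, s = (Finset.range n).filter (fun k =>
            (m.real 2 k - m.real 2 i) * (m.real 2 k - m.real 2 i) ≤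
            (m.real 2 j - m.real 2 i) * (m.real 2 j - m.real 2 i) ∧
            0 < (m.real 2 k - m.real 2 i) * (m.real 2 k - m.real 2 i)) →
            s.card = F (i * n + j) := by
          rintro _ rfl
          rw [hF]
          simp only [mul_add_div_mod hj]
          rfl
        rw [hr _ rfl, h60, zero_add]
        have hFn : F (i * n + j) ≤ L := (coverCount_le ..).trans hnL
        have hbd : ((m₂.setInt 3 0 n).setInt 6 (i * n + j) (F (i * n + j))).Bounded L :=
          (g2.setInt hnL).setInt hFn
        refine ⟨by simp [Mem.setInt_int, g1], hbd, Mem.setInt_int_self .., hbd.setInt (by omega),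
          by simp [Mem.setInt_int, g3], fun b b1 b2 b3 b6 => ?_, fun q => ?_, g6⟩
        · rw [Mem.setInt_int_of_ne _ _ _ b2, Mem.setInt_int_of_ne _ _ _ b6,
            Mem.setInt_int_of_ne _ _ _ b3, g4 b b1 b2 b3 b6]
        · simp only [Mem.setInt_int]
          norm_num
          rcases lt_trichotomy q (i * n + j) with h | rfl | h
          · rw [if_neg (by omega), if_pos (by omega), g5, if_pos h]
          · simp
          · rw [if_neg (by omega), if_neg (by omega), g5, if_neg (by omega)]
      · simp only [Test.cost, RealExpr.cost, IntExpr.cost, sqDiff]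
        ring_nf
        omega
    · rintro m' ⟨g1, g2, g3, g4, g5, g6⟩
      refine ⟨g3, g2, Mem.setInt_int_self .., g2.setInt (by omega), fun b b1 b2 b3 b6 => ?_,
        fun q => ?_, g6⟩
      · rw [Mem.setInt_int_of_ne _ _ _ b1, g4 b b1 b2 b3 b6]
      · rw [Mem.setInt_int_of_ne _ _ _ (by norm_num), g5, Nat.succ_mul]
  · rintro m' ⟨-, h2, h3, h4, h5⟩
    refine ⟨h2, h3, fun i hi j hj => ?_, h5⟩
    have : (i + 1) * n ≤ n * n := Nat.mul_le_mul_right n hi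
    rw [Nat.succ_mul] at this
    rw [h4, if_pos (by omega), hF]
    simp only [mul_add_div_mod hj]

/-! ### Recording the best candidate -/

/-- The expression reads the integer arrays `0, …, 6` only. -/
def IntExpr.Low : IntExpr → Prop
  | const _ => True
  | read a i => a < 7 ∧ i.Low
  | add e f => e.Low ∧ f.Low
  | sub e f => e.Low ∧ f.Low
  | mul e f => e.Low ∧ f.Low

/-- The test reads the integer arrays `0, …, 6` only. -/
def Test.Low : Test → Prop
  | intLt e f => e.Low ∧ f.Low
  | realLt _ _ => False
  | not b => b.Low
  | and b c => b.Low ∧ c.Low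

/-- Relaxation writes only to arrays numbered `7` and above, so the guards and the numbers of
sources keep their values while candidates are being compared. -/
theorem IntExpr.Low.eval_congr {m m' : Mem} (h : ∀ a < 7, m.int a = m'.int a) {e : IntExpr}
    (he : e.Low) : e.eval m = e.eval m' := by
  induction e with
  | const k => rfl
  | read a i ih => simp only [eval, ih he.2, h a he.1]
  | add e f ihe ihf => simp only [eval, ihe he.1, ihf he.2]
  | sub e f ihe ihf => simp only [eval, ihe he.1, ihf he.2]
  | mul e f ihe ihf => simp only [eval, ihe he.1, ihf he.2]

theorem Test.Low.holds_congr {m m' : Mem} (h : ∀ a < 7, m.int a = m'.int a) {b : Test}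
    (hb : b.Low) : b.Holds m ↔ b.Holds m' := by
  induction b with
  | intLt e f => simp only [Holds, hb.1.eval_congr h, hb.2.eval_congr h]
  | realLt e f => exact hb.elim
  | not b ih => simp only [Holds, ih hb]
  | and b c ihb ihc => simp only [Holds, ihb hb.1, ihc hb.2]

/-- A candidate for the solution of a subproblem: if the guard holds, then solutions of the
subproblems `s₁` and `s₂` can be combined by spending `w` at `u`. -/
structure Cand where
  guard : Test
  s₁ : IntExpr
  s₂ : IntExpr
  u : IntExpr
  w : IntExpr

namespace Cand

/-- The expressions are small and read the integer arrays `0, …, 6` only. -/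
structure Ok (c : Cand) : Prop where
  guard_light : c.guard.Light 100
  guard_low : c.guard.Low
  s₁_weight : c.s₁.weight ≤ 30
  s₁_low : c.s₁.Low
  s₂_weight : c.s₂.weight ≤ 30
  s₂_low : c.s₂.Low
  u_weight : c.u.weight ≤ 30
  u_low : c.u.Low
  w_weight : c.w.weight ≤ 30
  w_low : c.w.Low

/-- The candidate evaluates to the given numbers. -/
def Gives (c : Cand) (m : Mem) (s₁ s₂ u w : ℕ) : Prop :=
  c.guard.Holds m ∧ c.s₁.eval m = s₁ ∧ c.s₂.eval m = s₂ ∧ c.u.eval m = u ∧ c.w.eval m = w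

/-- The cost of the candidate. -/
def val (c : Cand) : IntExpr := .add (.add (.read 7 c.s₁) (.read 7 c.s₂)) c.w

/-- Record the candidate if it is better than the best one so far. -/
def relax (t : IntExpr) (c : Cand) : Prog :=
  .ite (.and c.guard (.intLt c.val (.read 7 t)))
    (.seq (.setInt 7 t c.val) (.seq (.setInt 9 (.const 0) c.s₁) (.seq (.setInt 10 (.const 0) c.s₂)
      (.seq (.setInt 11 (.const 0) c.u) (.setInt 12 (.const 0) c.w))))) .skip

/-- Try all candidates in the list. -/
def relaxAll (t : IntExpr) : List Cand → Prog
  | [] => .skip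
  | c :: l => .seq (c.relax t) (relaxAll t l)

end Cand

/-- The best candidate among those in `S` has been recorded; `M` stands for infinity. -/
structure Best (L M n : ℕ) (m₀ : Mem) (τ : ℕ) (S : ℕ → ℕ → ℕ → ℕ → Prop) (m : Mem) : Prop where
  bounded : m.Bounded L
  int_eq : ∀ b, b ≠ 4 → b ≠ 7 → b ≠ 9 → b ≠ 10 → b ≠ 11 → b ≠ 12 → m.int b = m₀.int b
  real_eq : m.real = m₀.real
  val_eq : ∀ i ≠ τ, m.int 7 i = m₀.int 7 i
  le : ∀ s₁ s₂ u w, S s₁ s₂ u w → m.int 7 τ ≤ m₀.int 7 s₁ + m₀.int 7 s₂ + w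
  attained : M ≤ m.int 7 τ ∨ ∃ s₁ s₂ u w, S s₁ s₂ u w ∧
    m.int 7 τ = m₀.int 7 s₁ + m₀.int 7 s₂ + w ∧ s₁ < τ ∧ s₂ < τ ∧ u < n ∧
    m.int 9 0 = s₁ ∧ m.int 10 0 = s₂ ∧ m.int 11 0 = u ∧ m.int 12 0 = w

theorem Best.congr {L M n : ℕ} {m₀ m : Mem} {τ : ℕ} {S S' : ℕ → ℕ → ℕ → ℕ → Prop}
    (h : Best L M n m₀ τ S m) (hS : ∀ s₁ s₂ u w, S s₁ s₂ u w ↔ S' s₁ s₂ u w) :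
    Best L M n m₀ τ S' m := by
  obtain rfl : S = S' := by
    funext s₁ s₂ u w
    exact propext (hS s₁ s₂ u w)
  exact h

section

variable {L B M n τ j : ℕ} {m₀ m : Mem} {t : IntExpr} {S : ℕ → ℕ → ℕ → ℕ → Prop}

/-- The sources are numbered below `τ`, so their costs are not affected by updates of entry `τ`, and
costs in the current memory agree with those in `m₀`. -/
theorem runs_relax (hB : WordSize L 100 B) (ht : t.Low) (htw : t.weight ≤ 30)
    (htτ : t.eval (m₀.setInt 4 0 j) = τ) (hτ : τ ≤ L) (hn : n ≤ L) {c : Cand} (hc : c.Ok)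
    (hsrc : ∀ s₁ s₂ u w, c.Gives (m₀.setInt 4 0 j) s₁ s₂ u w → s₁ < τ ∧ s₂ < τ ∧ u < n)
    (h : Best L M n m₀ τ S m) (h4 : m.int 4 = (m₀.setInt 4 0 j).int 4) :
    Runs B (c.relax t) m (c.relax t).cost fun m' =>
      m'.int 4 = (m₀.setInt 4 0 j).int 4 ∧
      Best L M n m₀ τ
        (fun s₁ s₂ u w => S s₁ s₂ u w ∨ c.Gives (m₀.setInt 4 0 j) s₁ s₂ u w) m' := by
  have hlow : ∀ m' : Mem, m'.int 4 = (m₀.setInt 4 0 j).int 4 →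
      (∀ b, b ≠ 4 → b < 7 → m'.int b = m₀.int b) → ∀ a < 7, m'.int a = (m₀.setInt 4 0 j).int a := by
    intro m' h4 hm' a ha
    by_cases h : a = 4
    · rw [h, h4]
    · rw [hm' a h ha, Mem.setInt_int_of_ne _ _ _ h]
  have hm := hlow m h4 fun b b4 b7 => h.int_eq b b4 (by omega) (by omega) (by omega) (by omega) (by omega)
  obtain ⟨g1, g2, w1, l1, w2, l2, w3, l3, w4, l4⟩ := hc
  have hc : c.Ok := ⟨g1, g2, w1, l1, w2, l2, w3, l3, w4, l4⟩
  have hval : c.val.weight ≤ 100 := by simp only [Cand.val, IntExpr.weight]; omega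
  set s₁ := c.s₁.eval (m₀.setInt 4 0 j) with hs₁
  set s₂ := c.s₂.eval (m₀.setInt 4 0 j) with hs₂
  set u := c.u.eval (m₀.setInt 4 0 j) with hu
  set w := c.w.eval (m₀.setInt 4 0 j) with hw
  have hve : c.val.eval m = m.int 7 s₁ + m.int 7 s₂ + w := by
    simp only [Cand.val, IntExpr.eval, l1.eval_congr hm, l2.eval_congr hm, l4.eval_congr hm, hs₁,
      hs₂, hw]
  have hte : t.eval m = τ := by rw [ht.eval_congr hm, htτ]
  have hlight : (Test.and c.guard (.intLt c.val (.read 7 t))).Light 100 :=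
    ⟨g1, hval, by simp only [IntExpr.weight]; omega⟩
  refine (Runs.ite hB h.bounded hlight (fun hb => ?_)
    (fun hb => Runs.skip ⟨h4, ?_⟩)).mono le_rfl fun _ h => h
  · obtain ⟨hg, hlt⟩ := hb
    change c.val.eval m < m.int 7 (t.eval m) at hlt
    rw [hte, hve] at hlt
    obtain ⟨i1, i2, i3⟩ := hsrc s₁ s₂ u w ⟨(g2.holds_congr hm).1 hg, rfl, rfl, rfl, rfl⟩
    rw [h.val_eq s₁ i1.ne, h.val_eq s₂ i2.ne] at hlt hve
    set x := m₀.int 7 s₁ + m₀.int 7 s₂ + w with hx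
    -- A recorded value is smaller than the one it replaces, so infinite or excessive sums are never
    -- stored.
    have hxL : x ≤ L := hlt.le.trans (h.bounded _ _)
    have e1 : ∀ m' : Mem, (∀ a < 7, m'.int a = m.int a) → c.s₁.eval m' = s₁ := fun m' h' =>
      l1.eval_congr fun a ha => (h' a ha).trans (hm a ha)
    have e2 : ∀ m' : Mem, (∀ a < 7, m'.int a = m.int a) → c.s₂.eval m' = s₂ := fun m' h' =>
      l2.eval_congr fun a ha => (h' a ha).trans (hm a ha)
    have e3 : ∀ m' : Mem, (∀ a < 7, m'.int a = m.int a) → c.u.eval m' = u := fun m' h' =>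
      l3.eval_congr fun a ha => (h' a ha).trans (hm a ha)
    have e4 : ∀ m' : Mem, (∀ a < 7, m'.int a = m.int a) → c.w.eval m' = w := fun m' h' =>
      l4.eval_congr fun a ha => (h' a ha).trans (hm a ha)
    have b1 : (m.setInt 7 τ x).Bounded L := h.bounded.setInt hxL
    have b2 : ((m.setInt 7 τ x).setInt 9 0 s₁).Bounded L := b1.setInt (by omega)
    have b3 : (((m.setInt 7 τ x).setInt 9 0 s₁).setInt 10 0 s₂).Bounded L := b2.setInt (by omega)
    have b4 : ((((m.setInt 7 τ x).setInt 9 0 s₁).setInt 10 0 s₂).setInt 11 0 u).Bounded L :=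
      b3.setInt (by omega)
    have f1 : ∀ a < 7, (m.setInt 7 τ x).int a = m.int a := fun a ha =>
      Mem.setInt_int_of_ne _ _ _ (by omega)
    have f2 : ∀ a < 7, ((m.setInt 7 τ x).setInt 9 0 s₁).int a = m.int a := fun a ha => by
      rw [Mem.setInt_int_of_ne _ _ _ (by omega), f1 a ha]
    have f3 : ∀ a < 7, (((m.setInt 7 τ x).setInt 9 0 s₁).setInt 10 0 s₂).int a = m.int a :=
      fun a ha => by rw [Mem.setInt_int_of_ne _ _ _ (by omega), f2 a ha]
    have f4 : ∀ a < 7, ((((m.setInt 7 τ x).setInt 9 0 s₁).setInt 10 0 s₂).setInt 11 0 u).int a =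
      m.int a := fun a ha => by rw [Mem.setInt_int_of_ne _ _ _ (by omega), f3 a ha]
    refine Runs.seq (Runs.setInt hB h.bounded (by omega) hval ?_)
    rw [hte, hve]
    refine Runs.seq (Runs.setInt hB b1 (Nat.zero_le _) (by omega) ?_)
    rw [e1 _ f1]
    refine Runs.seq (Runs.setInt hB b2 (Nat.zero_le _) (by omega) ?_)
    simp only [IntExpr.eval]
    rw [e2 _ f2]
    refine Runs.seq (Runs.setInt hB b3 (Nat.zero_le _) (by omega) ?_)
    simp only [IntExpr.eval]
    rw [e3 _ f3]
    refine Runs.setInt hB b4 (Nat.zero_le _) (by omega) ?_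
    simp only [IntExpr.eval]
    rw [e4 _ f4]
    have e7 : ∀ i, (((((m.setInt 7 τ x).setInt 9 0 s₁).setInt 10 0 s₂).setInt 11 0 u).setInt 12 0
        w).int 7 i = if i = τ then x else m.int 7 i := fun i => by
      simp [Mem.setInt_int]
    refine ⟨?_, b4.setInt (by omega), fun b c4 c7 c9 c10 c11 c12 => ?_, h.real_eq, fun i hi => ?_,
      ?_, .inr ⟨s₁, s₂, u, w, .inr ⟨(g2.holds_congr hm).1 hg, rfl, rfl, rfl, rfl⟩, ?_, i1, i2, i3,
        ?_, ?_, ?_, ?_⟩⟩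
    · rw [Mem.setInt_int_of_ne _ _ _ (by omega), f4 4 (by omega), h4]
    · simp only [Mem.setInt_int_of_ne _ _ _ c7, Mem.setInt_int_of_ne _ _ _ c9,
        Mem.setInt_int_of_ne _ _ _ c10, Mem.setInt_int_of_ne _ _ _ c11,
        Mem.setInt_int_of_ne _ _ _ c12]
      exact h.int_eq b c4 c7 c9 c10 c11 c12
    · rw [e7, if_neg hi, h.val_eq i hi]
    · rintro s₁' s₂' u' w' (hS | ⟨-, h1, h2, h3, h4⟩)
      · rw [e7, if_pos rfl]
        exact hlt.le.trans (h.le _ _ _ _ hS)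
      · rw [e7, if_pos rfl, ← h1, ← h2, ← h4]
    · rw [e7, if_pos rfl]
    all_goals simp [Mem.setInt_int]
  · refine ⟨h.bounded, h.int_eq, h.real_eq, h.val_eq, ?_, h.attained.imp id ?_⟩
    · rintro s₁' s₂' u' w' (hS | hG)
      · exact h.le _ _ _ _ hS
      · obtain ⟨i1, i2, -⟩ := hsrc _ _ _ _ hG
        obtain ⟨hg, rfl, rfl, rfl, rfl⟩ := hG
        have : ¬ c.val.eval m < m.int 7 τ := fun hlt =>
          hb ⟨(g2.holds_congr hm).2 hg, by
            change c.val.eval m < m.int 7 (t.eval m)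
            rwa [hte]⟩
        rw [hve, h.val_eq s₁ i1.ne, h.val_eq s₂ i2.ne] at this
        exact not_lt.1 this
    · rintro ⟨s₁, s₂, u, w, hS, h⟩
      exact ⟨s₁, s₂, u, w, .inl hS, h⟩

theorem runs_relaxAll (hB : WordSize L 100 B) (ht : t.Low) (htw : t.weight ≤ 30)
    (htτ : t.eval (m₀.setInt 4 0 j) = τ) (hτ : τ ≤ L) (hn : n ≤ L) (l : List Cand)
    (hl : ∀ c ∈ l, c.Ok)
    (hsrc : ∀ c ∈ l, ∀ s₁ s₂ u w, c.Gives (m₀.setInt 4 0 j) s₁ s₂ u w → s₁ < τ ∧ s₂ < τ ∧ u < n)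
    (h : Best L M n m₀ τ S m) (h4 : m.int 4 = (m₀.setInt 4 0 j).int 4) :
    Runs B (Cand.relaxAll t l) m (Cand.relaxAll t l).cost fun m' =>
      m'.int 4 = (m₀.setInt 4 0 j).int 4 ∧
      Best L M n m₀ τ (fun s₁ s₂ u w => S s₁ s₂ u w ∨
        ∃ c ∈ l, c.Gives (m₀.setInt 4 0 j) s₁ s₂ u w) m' := by
  induction l generalizing S m with
  | nil => exact Runs.skip ⟨h4, h.congr fun s₁ s₂ u w => by simp⟩
  | cons c l ih =>
    refine Runs.seq ((runs_relax hB ht htw htτ hτ hn (hl c (by simp)) (hsrc c (by simp)) h h4).mono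
      le_rfl fun m' hm' => ?_)
    refine (ih (fun c hc => hl c (by simp [hc])) (fun c hc => hsrc c (by simp [hc])) hm'.2
      hm'.1).mono le_rfl fun m'' hm'' => ⟨hm''.1, hm''.2.congr fun s₁ s₂ u w => ?_⟩
    simp [or_assoc]

/-! ### Solving one subproblem -/

/-- The maximum of two integers. -/
def maxExpr (e f : IntExpr) : IntExpr := .add e (.sub f e)

theorem maxExpr_eval (e f : IntExpr) (m : Mem) :
    (maxExpr e f).eval m = max (e.eval m) (f.eval m) := by
  simp only [maxExpr, IntExpr.eval]
  omega

/-- Infinity for the costs. -/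
def infExpr : IntExpr := .mul (.add (var 0) (.const 1)) (.add (var 0) (.const 1))

/-- Cell `i` of the solution of subproblem `s`. -/
def cellExpr (s i : IntExpr) : IntExpr := .read 8 (.add (.mul s (var 0)) i)

/-- Combine the solutions according to the recorded candidate. -/
def combineProg (t : IntExpr) : Prog :=
  .seq (forLoop 14 (var 0) (.setInt 8 (.add (.mul t (var 0)) (var 14))
      (maxExpr (cellExpr (var 9) (var 14)) (cellExpr (var 10) (var 14)))))
    (.setInt 8 (.add (.mul t (var 0)) (var 11)) (maxExpr (cellExpr t (var 11)) (var 12)))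

/-- Solve subproblem `t`, given a list of candidates that may depend on a number `j < n` in
integer array `4`. -/
def solveProg (t : IntExpr) (l : List Cand) : Prog :=
  .seq (.setInt 7 t infExpr) (.seq (forLoop 4 (var 0) (Cand.relaxAll t l))
    (.ite (.intLt (.read 7 t) infExpr) (combineProg t) .skip))

/-- Rows `s₁` and `s₂` of the solution array end before row `τ` starts, so they are intact while row
`τ` is being written. Cell `u` is raised to `w` afterwards. -/
theorem runs_combineProg (hB : WordSize L 100 B) (ht : t.Low) (htw : t.weight ≤ 30)
    (hm : m.Bounded L) (hn : m.int 0 0 = n) (htτ : t.eval m = τ) {s₁ s₂ u w : ℕ}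
    (h9 : m.int 9 0 = s₁) (h10 : m.int 10 0 = s₂) (h11 : m.int 11 0 = u) (h12 : m.int 12 0 = w)
    (hs₁ : s₁ < τ) (hs₂ : s₂ < τ) (hu : u < n) :
    Runs B (combineProg t) m (n * (3 * t.cost + 72) + 3 * t.cost + 72) fun m' =>
      m'.Bounded L ∧ (∀ b, b ≠ 8 → b ≠ 14 → m'.int b = m.int b) ∧ m'.real = m.real ∧
      (∀ q < τ * n, m'.int 8 q = m.int 8 q) ∧
      ∀ i < n, m'.int 8 (τ * n + i) =
        max (max (m.int 8 (s₁ * n + i)) (m.int 8 (s₂ * n + i))) (if i = u then w else 0) := by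
  have hnL : n ≤ L := hn ▸ hm 0 0
  have hsrc : ∀ s < τ, ∀ i < n, s * n + i < τ * n := fun s hs i hi => by
    have : (s + 1) * n ≤ τ * n := Nat.mul_le_mul_right n hs
    rw [Nat.succ_mul] at this
    omega
  have hte : ∀ m' : Mem, (∀ b, b ≠ 8 → b ≠ 14 → m'.int b = m.int b) → t.eval m' = τ :=
    fun m' h => (ht.eval_congr fun a ha => h a (by omega) (by omega)).trans htτ
  refine (Runs.seq ((Runs.forLoop hB (by norm_num) hm (N := n) (T := t.cost + 45) (fun i m' =>
    i ≤ n ∧ m'.int 14 0 = i ∧ m'.Bounded L ∧ (∀ b, b ≠ 8 → b ≠ 14 → m'.int b = m.int b) ∧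
    m'.real = m.real ∧ (∀ q < τ * n, m'.int 8 q = m.int 8 q) ∧
    ∀ i' < i, m'.int 8 (τ * n + i') = max (m.int 8 (s₁ * n + i')) (m.int 8 (s₂ * n + i')))
    (Q := fun m' => m'.Bounded L ∧ (∀ b, b ≠ 8 → b ≠ 14 → m'.int b = m.int b) ∧
    m'.real = m.real ∧ (∀ q < τ * n, m'.int 8 q = m.int 8 q) ∧
    ∀ i' < n, m'.int 8 (τ * n + i') = max (m.int 8 (s₁ * n + i')) (m.int 8 (s₂ * n + i')))
    (by simp [IntExpr.weight]) ?_ ?_ ?_ ?_).mono le_rfl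
    (Q' := fun m' => Runs B _ m' (3 * t.cost + 45) _) fun m₁ ⟨h2, h3, h4, h5, h6⟩ => ?_)).mono ?_
    fun _ h => h
  · rintro k m' ⟨-, h1, h2, h3, -⟩
    exact ⟨h1, h2, by simp [IntExpr.eval, h3 0, hn]⟩
  · exact ⟨Nat.zero_le _, Mem.setInt_int_self .., hm.setInt (Nat.zero_le _),
      fun b _ b14 => Mem.setInt_int_of_ne _ _ _ b14, rfl,
      fun q _ => by rw [Mem.setInt_int_of_ne _ _ _ (by norm_num)], by simp⟩
  · rintro i hi m' ⟨-, h1, h2, h3, h4, h5, h6⟩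
    refine (Runs.setInt hB h2 (by simp only [IntExpr.weight]; omega)
      (by simp [IntExpr.weight, maxExpr, cellExpr]) ?_).mono ?_ fun _ h => h
    · simp only [IntExpr.eval, hte m' h3, maxExpr_eval, cellExpr, h1, h3 0 (by norm_num) (by norm_num),
        h3 9 (by norm_num) (by norm_num), h3 10 (by norm_num) (by norm_num), hn, h9, h10,
        h5 _ (hsrc s₁ hs₁ i hi), h5 _ (hsrc s₂ hs₂ i hi)]
      have hbd : (m'.setInt 8 (τ * n + i) (max (m.int 8 (s₁ * n + i)) (m.int 8 (s₂ * n + i)))).Bounded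
          L := h2.setInt (max_le (hm _ _) (hm _ _))
      refine ⟨by simp [Mem.setInt_int, h1], hbd, hi, Mem.setInt_int_self .., hbd.setInt (by omega),
        fun b b8 b14 => ?_, h4, fun q hq => ?_, fun i' hi' => ?_⟩
      · rw [Mem.setInt_int_of_ne _ _ _ b14, Mem.setInt_int_of_ne _ _ _ b8, h3 b b8 b14]
      · rw [Mem.setInt_int_of_ne _ _ _ (by norm_num), Mem.setInt_int, if_neg (by omega), h5 q hq]
      · rw [Mem.setInt_int_of_ne _ _ _ (by norm_num), Mem.setInt_int]
        rcases (Nat.le_of_lt_succ hi').lt_or_eq with h | rfl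
        · rw [if_neg (by omega), h6 i' h]
        · simp
    · simp only [IntExpr.cost, maxExpr, cellExpr]
      omega
  · rintro m' ⟨-, -, h⟩
    exact h
  · refine (Runs.setInt hB h2 (by simp only [IntExpr.weight]; omega)
      (by simp only [IntExpr.weight, maxExpr, cellExpr]; omega) ?_).mono ?_ fun _ h => h
    · simp only [IntExpr.eval, hte m₁ h3, maxExpr_eval, cellExpr, h3 0 (by norm_num) (by norm_num),
        h3 11 (by norm_num) (by norm_num), h3 12 (by norm_num) (by norm_num), hn, h11, h12, h6 u hu]
      refine ⟨h2.setInt (max_le (max_le (hm _ _) (hm _ _)) (h12 ▸ hm _ _)), fun b b8 b14 => ?_, h4,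
        fun q hq => ?_, fun i hi => ?_⟩
      · rw [Mem.setInt_int_of_ne _ _ _ b8, h3 b b8 b14]
      · rw [Mem.setInt_int, if_neg (by omega), h5 q hq]
      · rw [Mem.setInt_int]
        by_cases h : i = u
        · subst h; simp
        · rw [if_neg (by omega), h6 i hi, if_neg h, Nat.max_zero]
    · simp only [IntExpr.cost, maxExpr, cellExpr]
      omega
  · simp only [IntExpr.cost]
    ring_nf
    omega

/-- Subproblem `τ` has been solved, with candidates `S`. -/
def IsEntry (n M : ℕ) (m : Mem) (τ : ℕ) (S : ℕ → ℕ → ℕ → ℕ → Prop) : Prop :=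
  (∀ s₁ s₂ u w, S s₁ s₂ u w → m.int 7 τ ≤ m.int 7 s₁ + m.int 7 s₂ + w) ∧
  (M ≤ m.int 7 τ ∨ ∃ s₁ s₂ u w, S s₁ s₂ u w ∧ m.int 7 τ = m.int 7 s₁ + m.int 7 s₂ + w ∧
    ∀ i < n, m.int 8 (τ * n + i) =
      max (max (m.int 8 (s₁ * n + i)) (m.int 8 (s₂ * n + i))) (if i = u then w else 0))

/-- The bound is linear in `n`: a fixed list of candidates is tried for each `j < n`, and one vector
of length `n` is merged at the end. The merge is skipped if the entry is still infinite, when no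
candidate has been recorded. -/
theorem runs_solveProg (hB : WordSize L 100 B) (ht : t.Low) (htw : t.weight ≤ 30)
    (hm : m.Bounded L) (hn : m.int 0 0 = n) (hM : (n + 1) * (n + 1) ≤ L)
    (htτ : ∀ j, t.eval (m.setInt 4 0 j) = τ) (hτ : τ ≤ L) (l : List Cand) (hl : ∀ c ∈ l, c.Ok)
    (hsrc : ∀ j < n, ∀ c ∈ l, ∀ s₁ s₂ u w, c.Gives (m.setInt 4 0 j) s₁ s₂ u w →
      s₁ < τ ∧ s₂ < τ ∧ u < n) :
    Runs B (solveProg t l) m (n * ((Cand.relaxAll t l).cost + 3 * t.cost + 84) + 5 * t.cost + 200)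
      fun m' => m'.Bounded L ∧
        (∀ b, b ≠ 4 → (b < 7 ∨ 14 < b) → m'.int b = m.int b) ∧ m'.real = m.real ∧
        (∀ i ≠ τ, m'.int 7 i = m.int 7 i) ∧ (∀ q < τ * n, m'.int 8 q = m.int 8 q) ∧
        IsEntry n ((n + 1) * (n + 1)) m' τ fun s₁ s₂ u w =>
          ∃ j < n, ∃ c ∈ l, c.Gives (m.setInt 4 0 j) s₁ s₂ u w := by
  have hnL : n ≤ L := hn ▸ hm 0 0
  have hinf : ∀ m' : Mem, m'.int 0 = m.int 0 → infExpr.eval m' = (n + 1) * (n + 1) := fun m' h => by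
    simp [infExpr, IntExpr.eval, h, hn]
  have hiw : infExpr.weight ≤ 10 := by simp [infExpr, IntExpr.weight]
  set M := (n + 1) * (n + 1) with hMdef
  have htm : ∀ m' : Mem, (∀ a < 7, a ≠ 4 → m'.int a = m.int a) → (∃ j, m'.int 4 =
      (m.setInt 4 0 j).int 4) → t.eval m' = τ := by
    rintro m' h ⟨j, hj⟩
    rw [← htτ j]
    refine ht.eval_congr fun a ha => ?_
    by_cases h4 : a = 4
    · rw [h4, hj]
    · rw [h a ha h4, Mem.setInt_int_of_ne _ _ _ h4]
  have h44 : m.int 4 = (m.setInt 4 0 (m.int 4 0)).int 4 := by rw [Mem.setInt_same]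
  have htm0 : t.eval m = τ := htm m (fun _ _ _ => rfl) ⟨_, h44⟩
  refine (Runs.seq (T₂ := n * ((Cand.relaxAll t l).cost + 3 * t.cost + 84) + 4 * t.cost + 180)
    (Runs.setInt hB hm (by omega) (by omega) ?_)).mono
      (by simp only [infExpr, IntExpr.cost]; omega) fun _ h => h
  rw [htm0, hinf m rfl]
  set m₁ := m.setInt 7 τ M with hm₁
  have hb₁ : m₁.Bounded L := hm.setInt hM
  refine (Runs.seq (T₂ := n * (3 * t.cost + 72) + 4 * t.cost + 150)
    ((Runs.forLoop hB (by norm_num) hb₁ (N := n)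
    (T := (Cand.relaxAll t l).cost)
    (fun k m' => k ≤ n ∧ m'.int 4 = (m.setInt 4 0 k).int 4 ∧ Best L M n m τ
      (fun s₁ s₂ u w => ∃ j < k, ∃ c ∈ l, c.Gives (m.setInt 4 0 j) s₁ s₂ u w) m')
    (by simp [IntExpr.weight]) ?_ ?_ ?_ (fun m₂ h => ?_)).mono le_rfl fun _ h => h)).mono
      ?_ fun _ h => h
  · rintro k m' ⟨-, h1, h2⟩
    refine ⟨by rw [h1, Mem.setInt_int_self], h2.bounded, ?_⟩
    simp [IntExpr.eval, h2.int_eq 0, hn]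
  · refine ⟨Nat.zero_le _, by simp [hm₁, Mem.setInt], hb₁.setInt (Nat.zero_le _),
      fun b b4 b7 _ _ _ _ => ?_, rfl, fun i hi => ?_, ?_, .inl ?_⟩
    · rw [Mem.setInt_int_of_ne _ _ _ b4, Mem.setInt_int_of_ne _ _ _ b7]
    · rw [Mem.setInt_int_of_ne _ _ _ (by norm_num), hm₁, Mem.setInt_int, if_neg (by tauto)]
    · rintro s₁ s₂ u w ⟨j, hj, -⟩
      omega
    · rw [Mem.setInt_int_of_ne _ _ _ (by norm_num), hm₁, Mem.setInt_int_self]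
  · rintro k hk m' ⟨-, h1, h2⟩
    refine (runs_relaxAll hB ht htw (htτ k) hτ hnL l hl (hsrc k hk) h2 h1).mono le_rfl ?_
    rintro m'' ⟨g1, g2⟩
    refine ⟨by rw [g1, Mem.setInt_int_self], g2.bounded, hk, ?_, ?_⟩
    · funext i
      simp only [Mem.setInt_int, g1]
      split_ifs <;> rfl
    · refine Best.congr (S := fun s₁ s₂ u w => (∃ j < k, ∃ c ∈ l, c.Gives (m.setInt 4 0 j) s₁ s₂ u w)
        ∨ ∃ c ∈ l, c.Gives (m.setInt 4 0 k) s₁ s₂ u w) ?_ fun s₁ s₂ u w => ?_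
      · refine ⟨g2.bounded.setInt (by omega), fun b b4 b7 b9 b10 b11 b12 => ?_, g2.real_eq, ?_, ?_, ?_⟩
        · rw [Mem.setInt_int_of_ne _ _ _ b4, g2.int_eq b b4 b7 b9 b10 b11 b12]
        all_goals simp only [Mem.setInt_int_of_ne _ _ _ (show (7 : ℕ) ≠ 4 by norm_num),
          Mem.setInt_int_of_ne _ _ _ (show (9 : ℕ) ≠ 4 by norm_num),
          Mem.setInt_int_of_ne _ _ _ (show (10 : ℕ) ≠ 4 by norm_num),
          Mem.setInt_int_of_ne _ _ _ (show (11 : ℕ) ≠ 4 by norm_num),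
          Mem.setInt_int_of_ne _ _ _ (show (12 : ℕ) ≠ 4 by norm_num)]
        exacts [g2.val_eq, g2.le, g2.attained]
      · constructor
        · rintro (⟨j, hj, h⟩ | h)
          · exact ⟨j, by omega, h⟩
          · exact ⟨k, by omega, h⟩
        · rintro ⟨j, hj, h⟩
          rcases (Nat.le_of_lt_succ hj).lt_or_eq with hj | rfl
          · exact .inl ⟨j, hj, h⟩
          · exact .inr h
  · obtain ⟨-, h4, hbest⟩ := h
    have hbase : ∀ b, b ≠ 4 → (b < 7 ∨ 14 < b) → m₂.int b = m.int b := fun b b4 hb =>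
      hbest.int_eq b b4 (by omega) (by omega) (by omega) (by omega) (by omega)
    have hte : t.eval m₂ = τ := htm m₂ (fun a ha h4 => hbase a h4 (.inl ha)) ⟨_, h4⟩
    have h8 : m₂.int 8 = m.int 8 := hbest.int_eq 8 (by norm_num) (by norm_num) (by norm_num)
      (by norm_num) (by norm_num) (by norm_num)
    have hlt : (Test.intLt (.read 7 t) infExpr).Holds m₂ ↔ m₂.int 7 τ < M := by
      simp only [Test.Holds, IntExpr.eval, hte, hinf m₂ (hbase 0 (by norm_num) (by norm_num))]
    have hle : ∀ s₁ s₂ u w, (∃ j < n, ∃ c ∈ l, c.Gives (m.setInt 4 0 j) s₁ s₂ u w) →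
        m₂.int 7 τ ≤ m₂.int 7 s₁ + m₂.int 7 s₂ + w := by
      intro s₁ s₂ u w hS
      have h := hbest.le _ _ _ _ hS
      obtain ⟨j, hj, c, hc, hg⟩ := hS
      obtain ⟨i1, i2, -⟩ := hsrc j hj c hc _ _ _ _ hg
      rwa [hbest.val_eq s₁ i1.ne, hbest.val_eq s₂ i2.ne]
    have hlight : (Test.intLt (.read 7 t) infExpr).Light 100 :=
      ⟨by simp only [IntExpr.weight]; omega, by omega⟩
    refine (Runs.ite hB hbest.bounded (T₁ := n * (3 * t.cost + 72) + 3 * t.cost + 72) (T₂ := 1)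
      hlight (fun hb => ?_)
      (fun hb => Runs.skip ?_)).mono ?_ fun _ h => h
    · rw [hlt] at hb
      obtain ⟨s₁, s₂, u, w, hS, heq, i1, i2, hu, e9, e10, e11, e12⟩ :=
        hbest.attained.resolve_left (by omega)
      refine (runs_combineProg hB ht htw hbest.bounded
        (by rw [hbase 0 (by norm_num) (by norm_num), hn]) hte e9 e10 e11 e12 i1 i2 hu).mono le_rfl ?_
      rintro m₃ ⟨f1, f2, f3, f4, f5⟩
      have f7 : m₃.int 7 = m₂.int 7 := f2 7 (by norm_num) (by norm_num)
      refine ⟨f1, fun b b4 hb => ?_, f3.trans hbest.real_eq, fun i hi => ?_, fun q hq => ?_, ?_,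
        .inr ⟨s₁, s₂, u, w, hS, ?_, fun i hi => ?_⟩⟩
      · rw [f2 b (by omega) (by omega), hbase b b4 hb]
      · rw [f7, hbest.val_eq i hi]
      · rw [f4 q hq, h8]
      · rw [f7]; exact hle
      · rw [f7, hbest.val_eq s₁ i1.ne, hbest.val_eq s₂ i2.ne, heq]
      · have hs : ∀ s < τ, s * n + i < τ * n := fun s hs => by
          have : (s + 1) * n ≤ τ * n := Nat.mul_le_mul_right n hs
          rw [Nat.succ_mul] at this
          omega
        rw [f5 i hi, f4 _ (hs s₁ i1), f4 _ (hs s₂ i2)]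
    · rw [hlt] at hb
      exact ⟨hbest.bounded, hbase, hbest.real_eq, hbest.val_eq, fun q _ => by rw [h8], hle,
        .inl (by omega)⟩
    · simp only [Test.cost, IntExpr.cost, infExpr]
      omega
  · simp only [IntExpr.cost]
    ring_nf
    omega

end

end RealRAM

/-! ### Injectivity of the numbering -/

namespace Interference.State

theorem mul_add_inj {n a b x y : ℕ} (hx : x < n) (hy : y < n) (h : a * n + x = b * n + y) :
    a = b ∧ x = y := by
  have h1 := RealRAM.mul_add_div_mod (i := a) hx
  have h2 := RealRAM.mul_add_div_mod (i := b) hy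
  rw [h] at h1
  exact ⟨h1.1.symm.trans h2.1, h1.2.symm.trans h2.2⟩

/-- The number of a subproblem in terms of its place in the order of processing. -/
theorem Valid.exists_id_eq {n : ℕ} {τ : State} (h : τ.Valid n) (h0 : τ ≠ zero) :
    ∃ s < n, ∃ p < 4, ∃ k < n, τ.id n = (4 * s + p) * n + k + 1 ∧
      τ = if p = 0 then gap (s - 1 - k) s else if p = 1 then up k s else
        if p = 2 then down k s else both s (s + k) := by
  cases τ with
  | zero => exact absurd rfl h0
  | gap x y =>
    obtain ⟨h1, h2⟩ := h
    refine ⟨y, h2, 0, by norm_num, y - 1 - x, by omega, rfl, ?_⟩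
    rw [if_pos rfl]
    congr 1
    omega
  | up v s => exact ⟨s, h.2, 1, by norm_num, v, h.1.trans h.2, rfl, rfl⟩
  | down u s => exact ⟨s, h.2, 2, by norm_num, u, h.1.trans h.2, rfl, rfl⟩
  | both s t =>
    obtain ⟨h1, h2⟩ := h
    refine ⟨s, by omega, 3, by norm_num, t - s, by omega, rfl, ?_⟩
    simp only [OfNat.ofNat_ne_zero, OfNat.ofNat_ne_one, Nat.reduceEqDiff, if_false]
    congr 1
    omega

/-- The program knows a subproblem only by its number; injectivity ensures that all candidates found
for it are steps of one and the same state. -/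
theorem id_injOn {n : ℕ} {τ τ' : State} (h : τ.Valid n) (h0 : τ ≠ zero) (h' : τ'.Valid n)
    (h0' : τ' ≠ zero) (hid : τ.id n = τ'.id n) : τ = τ' := by
  obtain ⟨s, hs, p, hp, k, hk, e, rfl⟩ := h.exists_id_eq h0
  obtain ⟨s', hs', p', hp', k', hk', e', rfl⟩ := h'.exists_id_eq h0'
  rw [e, e'] at hid
  obtain ⟨h1, rfl⟩ := mul_add_inj hk hk' (Nat.succ_injective hid)
  obtain rfl : s = s' := by omega
  obtain rfl : p = p' := by omega
  rfl

theorem Step.ne_zero {n : ℕ} {c : ℕ → ℕ → ℕ} {τ σ₁ σ₂ : State} {u w : ℕ}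
    (h : Step n c τ σ₁ σ₂ u w) : τ ≠ zero := by
  cases h <;> simp

end Interference.State

/-! ### The steps of the recursion as machine expressions -/

namespace RealRAM

open Interference Interference.State

/-- Entry `(i, j)` of the cost matrix. -/
def costExpr (i j : IntExpr) : IntExpr := .read 6 (.add (.mul i (var 0)) j)

/-- The minimum of two integers. -/
def minExpr (e f : IntExpr) : IntExpr := .sub e (.sub e f)

/-- The number of the subproblem of type `p` with parameters `s` and `k`. -/
def idExpr (p s k : IntExpr) : IntExpr :=
  .add (.add (.mul (.add (.mul (.const 4) s) p) (var 0)) k) (.const 1)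

/-- The number of the subproblem `gap x y`. -/
def gapExpr (x y : IntExpr) : IntExpr := idExpr (.const 0) y (.sub (.sub y (.const 1)) x)

/-- The number of the subproblem `up v s`. -/
def upExpr (v s : IntExpr) : IntExpr := idExpr (.const 1) s v

/-- The number of the subproblem `down u s`. -/
def downExpr (u s : IntExpr) : IntExpr := idExpr (.const 2) s u

/-- The number of the subproblem `both s t`. -/
def bothExpr (s t : IntExpr) : IntExpr := idExpr (.const 3) s (.sub t s)

/-- Equality test. -/
def eqTest (e f : IntExpr) : Test := .and (.not (.intLt e f)) (.not (.intLt f e))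

/-- The number of the current subproblem. -/
def currentExpr : IntExpr := idExpr (var 2) (var 1) (var 3)

/-- All candidates; the type of the subproblem and its parameters are in the integer arrays
`2`, `1` and `3`. -/
def cands : List Cand :=
  let s := var 1
  let p := var 2
  let k := var 3
  let j := var 4
  let x : IntExpr := .sub (.sub s (.const 1)) k
  let t : IntExpr := .add s k
  let g : Test := .and (eqTest p (.const 3)) (.and (.intLt j s) (.intLt t (var 0)))
  [⟨.and (eqTest p (.const 0)) (.and (eqTest k (.const 0)) (.intLt (.const 0) s)),
      .const 0, .const 0, s, .const 0⟩,
    ⟨.and (eqTest p (.const 0)) (.and (.intLt k s) (.and (.intLt x j) (.intLt j s))),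
      gapExpr x j, gapExpr j s, j, minExpr (costExpr j x) (costExpr j s)⟩,
    ⟨.and (eqTest p (.const 1)) (.intLt k s), bothExpr k s, gapExpr k s, s, .const 0⟩,
    ⟨.and (eqTest p (.const 1)) (.and (.intLt k j) (.intLt j s)),
      upExpr k j, gapExpr j s, j, costExpr j s⟩,
    ⟨.and (eqTest p (.const 2)) (.and (.intLt j k) (.intLt k s)),
      upExpr j k, gapExpr k s, s, costExpr s j⟩,
    ⟨.and (eqTest p (.const 3)) (eqTest s (.const 0)),
      .const 0, .const 0, .const 0, costExpr (.const 0) k⟩,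
    ⟨g, downExpr j s, .const 0, j, costExpr j t⟩,
    ⟨g, upExpr j s, .const 0, s, maxExpr (costExpr s j) (costExpr s t)⟩,
    ⟨g, bothExpr j t, gapExpr j s, s, costExpr s j⟩]

theorem cands_ok : ∀ c ∈ cands, c.Ok := by
  intro c hc
  simp only [cands, List.mem_cons, List.not_mem_nil, or_false] at hc
  rcases hc with rfl | rfl | rfl | rfl | rfl | rfl | rfl | rfl | rfl <;>
    constructor <;>
    simp [Test.Light, Test.Low, IntExpr.weight, IntExpr.Low, eqTest, gapExpr, upExpr, downExpr,
      bothExpr, idExpr, costExpr, minExpr, maxExpr]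

/-- The loop variables and the number of points in a memory. -/
structure Context (m : Mem) (n s p k j : ℕ) : Prop where
  n_eq : m.int 0 0 = n
  s_eq : m.int 1 0 = s
  p_eq : m.int 2 0 = p
  k_eq : m.int 3 0 = k
  j_eq : m.int 4 0 = j

section

variable {m : Mem} {n s p k j s₁ s₂ u w : ℕ} {C : ℕ → ℕ → ℕ}

theorem eqTest_holds (e f : IntExpr) : (eqTest e f).Holds m ↔ e.eval m = f.eval m := by
  simp only [eqTest, Test.Holds]
  omega

theorem minExpr_eval (e f : IntExpr) : (minExpr e f).eval m = min (e.eval m) (f.eval m) := by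
  simp only [minExpr, IntExpr.eval]
  omega

/-- Soundness of the candidates. The guards bound all indices and ensure that truncated subtraction
recovers the intended parameters. -/
theorem Context.step_of_gives (h : Context m n s p k j)
    (hC : ∀ a < n, ∀ b < n, m.int 6 (a * n + b) = C a b)
    (hs : s < n) (hk : k < n) (hj : j < n) {c : Cand} (hc : c ∈ cands)
    (hg : c.Gives m s₁ s₂ u w) :
    ∃ τ σ₁ σ₂, Step n C τ σ₁ σ₂ u w ∧ τ.id n = (4 * s + p) * n + k + 1 ∧ σ₁.id n = s₁ ∧
      σ₂.id n = s₂ := by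
  obtain ⟨hn, h1, h2, h3, h4⟩ := h
  have hC' : ∀ a b x, a < n → b < n → x = a * n + b → m.int 6 x = C a b := by
    rintro a b _ ha hb rfl
    exact hC a ha b hb
  simp only [cands, List.mem_cons, List.not_mem_nil, or_false] at hc
  rcases hc with rfl | rfl | rfl | rfl | rfl | rfl | rfl | rfl | rfl <;>
    simp only [Cand.Gives, Test.Holds, eqTest_holds, IntExpr.eval, gapExpr, upExpr, downExpr,
      bothExpr, idExpr, costExpr, minExpr_eval, maxExpr_eval, hn, h1, h2, h3, h4] at hg
  · obtain ⟨⟨rfl, rfl, g⟩, rfl, rfl, rfl, rfl⟩ := hg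
    obtain ⟨x, rfl⟩ : ∃ x, s = x + 1 := ⟨s - 1, by omega⟩
    exact ⟨_, _, _, Step.gap_succ hs, by simp [State.id], rfl, rfl⟩
  · obtain ⟨⟨rfl, g1, g2, g3⟩, rfl, rfl, rfl, rfl⟩ := hg
    rw [hC _ hj _ (by omega), hC _ hj _ hs]
    refine ⟨_, _, _, Step.gap_split g2 g3 hs, ?_, rfl, rfl⟩
    simp only [State.id]
    congr 2
    omega
  · obtain ⟨⟨rfl, g⟩, rfl, rfl, rfl, rfl⟩ := hg
    exact ⟨_, _, _, Step.up_of_both g hs, rfl, rfl, rfl⟩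
  · obtain ⟨⟨rfl, g1, g2⟩, rfl, rfl, rfl, rfl⟩ := hg
    rw [hC _ hj _ hs]
    exact ⟨_, _, _, Step.up_of_up g1 g2 hs, rfl, rfl, rfl⟩
  · obtain ⟨⟨rfl, g1, g2⟩, rfl, rfl, rfl, rfl⟩ := hg
    rw [hC _ hs _ hj]
    exact ⟨_, _, _, Step.down_of_up g1 g2 hs, rfl, rfl, rfl⟩
  · obtain ⟨⟨rfl, rfl⟩, rfl, rfl, rfl, rfl⟩ := hg
    rw [hC _ hs _ hk]
    exact ⟨_, _, _, Step.both_zero hk, rfl, rfl, rfl⟩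
  · obtain ⟨⟨rfl, g1, g2⟩, rfl, rfl, rfl, rfl⟩ := hg
    rw [hC _ hj _ g2]
    refine ⟨_, _, _, Step.both_of_down g1 (Nat.le_add_right _ _) g2, ?_, rfl, rfl⟩
    simp [State.id]
  · obtain ⟨⟨rfl, g1, g2⟩, rfl, rfl, rfl, rfl⟩ := hg
    rw [hC _ hs _ g2, hC _ hs _ hj]
    refine ⟨_, _, _, Step.both_of_up g1 (Nat.le_add_right _ _) g2, ?_, rfl, rfl⟩
    simp [State.id]
  · obtain ⟨⟨rfl, g1, g2⟩, rfl, rfl, rfl, rfl⟩ := hg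
    rw [hC _ hs _ hj]
    refine ⟨_, _, _, Step.both_of_both g1 (Nat.le_add_right _ _) g2, ?_, rfl, rfl⟩
    simp [State.id]

/-- Completeness of the candidates. The witness `j` is the index of the step that the state leaves
free; for `gap_succ`, `up_of_both` and `both_zero`, which have none, `0` is taken. -/
theorem gives_of_step {τ σ₁ σ₂ : State} (h : Step n C τ σ₁ σ₂ u w) :
    ∃ s < n, ∃ p < 4, ∃ k < n, ∃ j < n, τ.id n = (4 * s + p) * n + k + 1 ∧
      ∀ m, Context m n s p k j → (∀ a < n, ∀ b < n, m.int 6 (a * n + b) = C a b) →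
        ∃ c ∈ cands, c.Gives m (σ₁.id n) (σ₂.id n) u w := by
  cases h with
  | @gap_succ x h =>
    refine ⟨x + 1, h, 0, by norm_num, 0, by omega, 0, by omega, by simp [State.id], fun m hm hC =>
      ⟨_, List.mem_cons_self, ?_⟩⟩
    obtain ⟨hn, h1, h2, h3, h4⟩ := hm
    simp [Cand.Gives, Test.Holds, eqTest_holds, IntExpr.eval, h1, h2, h3, State.id]
  | @gap_split x u y hxu huy hy =>
    refine ⟨y, hy, 0, by norm_num, y - 1 - x, by omega, u, by omega, rfl, fun m hm hC =>
      ⟨cands[1], List.getElem_mem _, ?_⟩⟩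
    obtain ⟨hn, h1, h2, h3, h4⟩ := hm
    have hx : y - 1 - (y - 1 - x) = x := by omega
    simp only [cands, List.getElem_cons_succ, List.getElem_cons_zero, Cand.Gives, Test.Holds,
      eqTest_holds, IntExpr.eval, gapExpr, idExpr, costExpr, minExpr_eval, hn, h1, h2, h3, h4, hx,
      hC u (by omega) x (by omega), hC u (by omega) y hy, State.id, and_true, true_and]
    omega
  | @up_of_both v _ hvs hs =>
    refine ⟨u, hs, 1, by norm_num, v, by omega, 0, by omega, rfl, fun m hm hC =>
      ⟨cands[2], List.getElem_mem _, ?_⟩⟩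
    obtain ⟨hn, h1, h2, h3, h4⟩ := hm
    simp only [cands, List.getElem_cons_succ, List.getElem_cons_zero, Cand.Gives, Test.Holds,
      eqTest_holds, IntExpr.eval, gapExpr, bothExpr, idExpr, hn, h1, h2, h3, State.id, hvs, and_true]
  | @up_of_up v u s hvu hus hs =>
    refine ⟨s, hs, 1, by norm_num, v, by omega, u, by omega, rfl, fun m hm hC =>
      ⟨cands[3], List.getElem_mem _, ?_⟩⟩
    obtain ⟨hn, h1, h2, h3, h4⟩ := hm
    simp only [cands, List.getElem_cons_succ, List.getElem_cons_zero, Cand.Gives, Test.Holds,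
      eqTest_holds, IntExpr.eval, gapExpr, upExpr, idExpr, costExpr, hn, h1, h2, h3, h4, State.id, hvu,
      hus, hC u (by omega) s hs, and_true]
  | @down_of_up v x _ hvu hus hs =>
    refine ⟨u, hs, 2, by norm_num, x, by omega, v, by omega, rfl, fun m hm hC =>
      ⟨cands[4], List.getElem_mem _, ?_⟩⟩
    obtain ⟨hn, h1, h2, h3, h4⟩ := hm
    simp only [cands, List.getElem_cons_succ, List.getElem_cons_zero, Cand.Gives, Test.Holds,
      eqTest_holds, IntExpr.eval, gapExpr, upExpr, idExpr, costExpr, hn, h1, h2, h3, h4, State.id, hvu,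
      hus, hC u hs v (by omega), and_true]
  | @both_zero t ht =>
    refine ⟨0, by omega, 3, by norm_num, t, ht, 0, by omega, rfl, fun m hm hC =>
      ⟨cands[5], List.getElem_mem _, ?_⟩⟩
    obtain ⟨hn, h1, h2, h3, h4⟩ := hm
    simp only [cands, List.getElem_cons_succ, List.getElem_cons_zero, Cand.Gives, Test.Holds,
      eqTest_holds, IntExpr.eval, costExpr, hn, h1, h2, h3, State.id, hC 0 (by omega) t ht, and_true]
  | @both_of_down u s t hus hst ht =>
    refine ⟨s, by omega, 3, by norm_num, t - s, by omega, u, by omega, rfl, fun m hm hC =>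
      ⟨cands[6], List.getElem_mem _, ?_⟩⟩
    obtain ⟨hn, h1, h2, h3, h4⟩ := hm
    simp only [cands, List.getElem_cons_succ, List.getElem_cons_zero, Cand.Gives, Test.Holds,
      eqTest_holds, IntExpr.eval, downExpr, idExpr, costExpr, hn, h1, h2, h3, h4, State.id, hus,
      Nat.add_sub_cancel' hst, ht, hC u (by omega) t ht, and_true]
  | @both_of_up v _ t hvs hst ht =>
    refine ⟨u, by omega, 3, by norm_num, t - u, by omega, v, by omega, rfl, fun m hm hC =>
      ⟨cands[7], List.getElem_mem _, ?_⟩⟩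
    obtain ⟨hn, h1, h2, h3, h4⟩ := hm
    simp only [cands, List.getElem_cons_succ, List.getElem_cons_zero, Cand.Gives, Test.Holds,
      eqTest_holds, IntExpr.eval, upExpr, idExpr, costExpr, maxExpr_eval, hn, h1, h2, h3, h4, State.id,
      hvs, Nat.add_sub_cancel' hst, ht, hC u (by omega) t ht, hC u (by omega) v (by omega),
      and_true]
  | @both_of_both v _ t hvs hst ht =>
    refine ⟨u, by omega, 3, by norm_num, t - u, by omega, v, by omega, rfl, fun m hm hC =>
      ⟨cands[8], List.getElem_mem _, ?_⟩⟩
    obtain ⟨hn, h1, h2, h3, h4⟩ := hm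
    simp only [cands, List.getElem_cons_succ, List.getElem_cons_zero, Cand.Gives, Test.Holds,
      eqTest_holds, IntExpr.eval, gapExpr, bothExpr, idExpr, costExpr, hn, h1, h2, h3, h4, State.id,
      hvs, Nat.add_sub_cancel' hst, ht, hC u (by omega) v (by omega), and_true]

end

/-! ### Filling the table -/

/-- Solve all subproblems. -/
def tableProg : Prog :=
  forLoop 1 (var 0) (forLoop 2 (.const 4) (forLoop 3 (var 0) (solveProg currentExpr cands)))

/-- The first `N` subproblems have been solved. -/
structure Solved (L n : ℕ) (C : ℕ → ℕ → ℕ) (m₀ : Mem) (N : ℕ) (m : Mem) : Prop where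
  bounded : m.Bounded L
  int_eq : ∀ b, b = 0 ∨ b = 5 ∨ b = 6 → m.int b = m₀.int b
  real_eq : m.real = m₀.real
  val_zero : m.int 7 0 = 0
  sol_zero : ∀ i < n, m.int 8 i = 0
  entry : ∀ τ σ, σ.Valid n → σ ≠ zero → σ.id n = τ → τ ≤ N →
    IsEntry n ((n + 1) * (n + 1)) m τ fun s₁ s₂ u w =>
      ∃ σ₁ σ₂, Step n C σ σ₁ σ₂ u w ∧ σ₁.id n = s₁ ∧ σ₂.id n = s₂

variable {L B n N : ℕ} {m m₀ : Mem} {C : ℕ → ℕ → ℕ}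

theorem Solved.setInt (h : Solved L n C m₀ N m) {a v : ℕ} (ha : a = 1 ∨ a = 2 ∨ a = 3) (hv : v ≤ L) :
    Solved L n C m₀ N (m.setInt a 0 v) := by
  have h7 : (m.setInt a 0 v).int 7 = m.int 7 := Mem.setInt_int_of_ne _ _ _ (by omega)
  have h8 : (m.setInt a 0 v).int 8 = m.int 8 := Mem.setInt_int_of_ne _ _ _ (by omega)
  refine ⟨h.bounded.setInt hv, fun b hb => ?_, h.real_eq, by rw [h7, h.val_zero], fun i hi => by
    rw [h8, h.sol_zero i hi], fun τ σ h1 h2 h3 h4 => ?_⟩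
  · rw [Mem.setInt_int_of_ne _ _ _ (by omega), h.int_eq b hb]
  · have := h.entry τ σ h1 h2 h3 h4
    simpa only [IsEntry, h7, h8] using this

theorem Solved.isTable (h : Solved L n C m₀ (4 * n * n) m) :
    IsTable n C ((n + 1) * (n + 1)) (m.int 7) fun τ i => m.int 8 (τ * n + i) := by
  have hle : ∀ σ : State, σ.Valid n → σ ≠ zero → σ.id n ≤ 4 * n * n := by
    intro σ hσ h0
    obtain ⟨s, hs, p, hp, k, hk, he, -⟩ := hσ.exists_id_eq h0
    have : (4 * s + p + 1) * n ≤ 4 * n * n := Nat.mul_le_mul_right n (by omega)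
    rw [Nat.succ_mul] at this
    omega
  refine ⟨h.val_zero, fun i hi => by rw [zero_mul, zero_add, h.sol_zero i hi],
    fun τ σ₁ σ₂ u w hs => ?_, fun τ hτ h0 => ?_⟩
  · exact (h.entry _ τ hs.valid.1 hs.ne_zero rfl (hle τ hs.valid.1 hs.ne_zero)).1 _ _ _ _
      ⟨σ₁, σ₂, hs, rfl, rfl⟩
  · refine (h.entry _ τ hτ h0 rfl (hle τ hτ h0)).2.imp (fun h => h) ?_
    rintro ⟨_, _, u, w, ⟨σ₁, σ₂, hs, rfl, rfl⟩, h1, h2⟩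
    exact ⟨σ₁, σ₂, u, w, hs, h1, h2⟩

/-- Constant in the time bound for the solution of a subproblem. -/
@[irreducible] def tableConst : ℕ := (Cand.relaxAll currentExpr cands).cost + 8 * currentExpr.cost + 400

theorem le_tableConst : n * ((Cand.relaxAll currentExpr cands).cost + 3 * currentExpr.cost + 84) +
    5 * currentExpr.cost + 200 ≤ n * tableConst + tableConst := by
  rw [tableConst]
  generalize (Cand.relaxAll currentExpr cands).cost = R
  generalize currentExpr.cost = c
  have h1 : n * (R + 3 * c + 84) ≤ n * (R + 8 * c + 400) := Nat.mul_le_mul_left n (by omega)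
  omega

/-- Older entries survive because they and their sources have numbers below `τ`, and nothing there
is overwritten. -/
theorem runs_solveProg_current (hB : WordSize L 100 B) (hn : m₀.int 0 0 = n)
    (hL : 4 * (n * n) + 4 * n + 4 ≤ L) (hC : ∀ a < n, ∀ b < n, m₀.int 6 (a * n + b) = C a b)
    {s p k : ℕ} (hs : s < n) (hp : p < 4) (hk : k < n) (h1 : m.int 1 0 = s) (h2 : m.int 2 0 = p)
    (h3 : m.int 3 0 = k) (h : Solved L n C m₀ ((4 * s + p) * n + k) m) :
    Runs B (solveProg currentExpr cands) m (n * tableConst + tableConst)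
      fun m' => m'.int 1 0 = s ∧ m'.int 2 0 = p ∧ m'.int 3 0 = k ∧
        Solved L n C m₀ ((4 * s + p) * n + (k + 1)) m' := by
  set τ := (4 * s + p) * n + k + 1 with hτ
  have h0 : m.int 0 0 = n := by rw [h.int_eq 0 (by simp), hn]
  have hctx : ∀ j, Context (m.setInt 4 0 j) n s p k j := fun j => by
    constructor <;> simp [Mem.setInt_int, h0, h1, h2, h3]
  have hC' : ∀ j, ∀ a < n, ∀ b < n, (m.setInt 4 0 j).int 6 (a * n + b) = C a b := fun j a ha b hb => by
    rw [Mem.setInt_int_of_ne _ _ _ (by norm_num), h.int_eq 6 (by simp), hC a ha b hb]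
  have hτL : τ ≤ L := by
    have : (4 * s + p + 1) * n ≤ 4 * n * n := Nat.mul_le_mul_right n (by omega)
    rw [Nat.succ_mul, mul_assoc 4] at this
    omega
  refine (runs_solveProg hB (t := currentExpr) (τ := τ)
    (by simp [currentExpr, idExpr, IntExpr.Low]) (by simp [currentExpr, idExpr, IntExpr.weight])
    h.bounded h0 (by ring_nf; ring_nf at hL; omega) (fun j => ?_) hτL cands cands_ok
    fun j hj c hc s₁ s₂ u w hg => ?_).mono le_tableConst ?_
  · simp [currentExpr, idExpr, IntExpr.eval, (hctx j).n_eq, (hctx j).s_eq, (hctx j).p_eq,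
      (hctx j).k_eq, hτ]
  · obtain ⟨τ', σ₁, σ₂, hst, he, rfl, rfl⟩ := (hctx j).step_of_gives (hC' j) hs hk hj hc hg
    rw [hτ, ← he]
    exact hst.id_lt
  · rintro m' ⟨g1, g2, g3, g4, g5, g6⟩
    -- Since `τ ≥ 1`, row `0`, the zero solution, is never touched.
    have hlow : ∀ q < n, q < τ * n := fun q hq => hq.trans_le (Nat.le_mul_of_pos_left n (by omega))
    refine ⟨by rw [g2 1 (by norm_num) (by norm_num), h1], by rw [g2 2 (by norm_num) (by norm_num), h2],
      by rw [g2 3 (by norm_num) (by norm_num), h3], g1, fun b hb => ?_, g3.trans h.real_eq, ?_, ?_, ?_⟩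
    · rw [g2 b (by omega) (by omega), h.int_eq b hb]
    · rw [g4 0 (by omega), h.val_zero]
    · intro i hi
      rw [g5 i (hlow i hi), h.sol_zero i hi]
    · intro τ' σ hv hz hid hle
      rcases (show τ' ≤ τ by omega).lt_or_eq with hlt | rfl
      · have hs : ∀ s < τ, ∀ i < n, s * n + i < τ * n := fun s hs i hi => by
          have : (s + 1) * n ≤ τ * n := Nat.mul_le_mul_right n hs
          rw [Nat.succ_mul] at this
          omega
        obtain ⟨e1, e2⟩ := h.entry τ' σ hv hz hid (by omega)
        have hsrc : ∀ {s₁ s₂ u w}, (∃ σ₁ σ₂, Step n C σ σ₁ σ₂ u w ∧ σ₁.id n = s₁ ∧ σ₂.id n = s₂) →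
            s₁ < τ ∧ s₂ < τ := by
          rintro _ _ u w ⟨σ₁, σ₂, hst, rfl, rfl⟩
          have := hst.id_lt
          omega
        refine ⟨fun s₁ s₂ u w hS => ?_, ?_⟩
        · have := hsrc hS
          rw [g4 _ hlt.ne, g4 _ this.1.ne, g4 _ this.2.ne]
          exact e1 _ _ _ _ hS
        · rw [g4 _ hlt.ne]
          refine e2.imp (fun h => h) ?_
          rintro ⟨s₁, s₂, u, w, hS, e3, e4⟩
          have := hsrc hS
          refine ⟨s₁, s₂, u, w, hS, ?_, fun i hi => ?_⟩
          · rw [g4 _ this.1.ne, g4 _ this.2.ne, e3]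
          · rw [g5 _ (hs _ hlt i hi), g5 _ (hs _ this.1 i hi), g5 _ (hs _ this.2 i hi), e4 i hi]
      -- The new entry: its candidates over all `j` coincide with the steps into `σ`, by
      -- completeness in one direction and by soundness with injectivity of the numbering in the
      -- other.
      · convert g6 using 1
        funext s₁ s₂ u w
        refine propext ⟨?_, ?_⟩
        · rintro ⟨σ₁, σ₂, hst, rfl, rfl⟩
          obtain ⟨s', hs', p', hp', k', hk', j, hj, he, hex⟩ := gives_of_step hst
          rw [hid] at he
          obtain ⟨i1, rfl⟩ := mul_add_inj hk hk' (Nat.succ_injective he)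
          obtain rfl : s = s' := by omega
          obtain rfl : p = p' := by omega
          exact ⟨j, hj, hex _ (hctx j) (hC' j)⟩
        · rintro ⟨j, hj, c, hc, hg⟩
          obtain ⟨τ', σ₁, σ₂, hst, he, rfl, rfl⟩ := (hctx j).step_of_gives (hC' j) hs hk hj hc hg
          obtain rfl := id_injOn hv hz hst.valid.1 hst.ne_zero (hid.trans he.symm)
          exact ⟨σ₁, σ₂, hst, rfl, rfl⟩

theorem runs_tableProg (hB : WordSize L 100 B) (hm : m.Bounded L) (hn : m.int 0 0 = n)
    (hL : 4 * (n * n) + 4 * n + 4 ≤ L) (hC : ∀ a < n, ∀ b < n, m.int 6 (a * n + b) = C a b)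
    (h7 : m.int 7 0 = 0) (h8 : ∀ i < n, m.int 8 i = 0) :
    Runs B tableProg m (n * (4 * (n * (n * tableConst + tableConst + 20) + 100) + 100) + 100)
      fun m' => Solved L n C m (4 * n * n) m' := by
  have hnL : n ≤ L := hn ▸ hm 0 0
  have start : Solved L n C m 0 m := ⟨hm, fun _ _ => rfl, rfl, h7, h8, fun τ σ hv hz hid hle => by
    obtain ⟨s, -, p, -, k, -, he, -⟩ := hv.exists_id_eq hz
    omega⟩
  have hbound : ∀ {N m'}, Solved L n C m N m' → (var 0).eval m' = n := fun h => by
    simp [IntExpr.eval, h.int_eq 0 (by simp), hn]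
  refine (Runs.forLoop hB (by norm_num) hm (N := n)
    (T := 4 * (n * (n * tableConst + tableConst + 20) + 100) + 70)
    (fun s m' => s ≤ n ∧ m'.int 1 0 = s ∧ Solved L n C m ((4 * s) * n) m')
    (by simp [IntExpr.weight]) ?_ ?_ ?_ ?_).mono
      (by simp only [IntExpr.cost]; ring_nf; omega) fun _ h => h
  · exact fun s m' ⟨_, h1, h⟩ => ⟨h1, h.bounded, hbound h⟩
  · refine ⟨Nat.zero_le _, Mem.setInt_int_self .., ?_⟩
    rw [mul_zero, zero_mul]
    exact start.setInt (by simp) (Nat.zero_le _)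
  · rintro s hs m₁ ⟨-, h1, h⟩
    refine (Runs.forLoop hB (by norm_num) h.bounded (N := 4)
      (T := n * (n * tableConst + tableConst + 20) + 50)
      (fun p m' => p ≤ 4 ∧ m'.int 1 0 = s ∧ m'.int 2 0 = p ∧ Solved L n C m ((4 * s + p) * n) m')
      (by simp [IntExpr.weight]) ?_ ?_ ?_ ?_).mono
        (by simp only [IntExpr.cost]; ring_nf; omega) fun _ h => h
    · exact fun p m' ⟨_, _, h2, h⟩ => ⟨h2, h.bounded, rfl⟩
    · exact ⟨Nat.zero_le _, by simp [Mem.setInt_int, h1], Mem.setInt_int_self ..,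
        h.setInt (by simp) (Nat.zero_le _)⟩
    · rintro p hp m₂ ⟨-, h1, h2, h⟩
      refine (Runs.forLoop hB (by norm_num) h.bounded (N := n)
        (T := n * tableConst + tableConst)
        (fun k m' => k ≤ n ∧ m'.int 1 0 = s ∧ m'.int 2 0 = p ∧ m'.int 3 0 = k ∧
          Solved L n C m ((4 * s + p) * n + k) m')
        (by simp [IntExpr.weight]) ?_ ?_ ?_ ?_).mono ?_ fun _ h => h
      · exact fun k m' ⟨_, _, _, h3, h⟩ => ⟨h3, h.bounded, hbound h⟩
      · exact ⟨Nat.zero_le _, by simp [Mem.setInt_int, h1], by simp [Mem.setInt_int, h2],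
          Mem.setInt_int_self .., h.setInt (by simp) (Nat.zero_le _)⟩
      · rintro k hk m₃ ⟨-, h1, h2, h3, h⟩
        refine (runs_solveProg_current hB hn hL hC hs hp hk h1 h2 h3 h).mono le_rfl ?_
        rintro m' ⟨g1, g2, g3, g⟩
        exact ⟨g3, g.bounded, hk, by simp [Mem.setInt_int, g1], by simp [Mem.setInt_int, g2],
          Mem.setInt_int_self .., g.setInt (by simp) (by omega)⟩
      · rintro m' ⟨-, h1, h2, -, h⟩
        rw [← Nat.succ_mul] at h
        exact ⟨h2, h.bounded, hp, by simp [Mem.setInt_int, h1], Mem.setInt_int_self ..,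
          h.setInt (by simp) (by omega)⟩
      · simp only [IntExpr.cost]
        ring_nf
        omega
    · rintro m' ⟨-, h1, -, h⟩
      have : (4 * s + 4) * n = 4 * (s + 1) * n := by ring
      rw [this] at h
      exact ⟨h1, h.bounded, hs, Mem.setInt_int_self .., h.setInt (by simp) (by omega)⟩
  · exact fun m' ⟨_, _, h⟩ => h

/-! ### Translating budgets to ranges -/

/-- The number of the last subproblem. -/
def lastExpr : IntExpr := idExpr (.const 3) (.sub (var 0) (.const 1)) (.const 0)

/-- Increase the range of the current point to `e` if the solution allows it to reach the `j`-th
point of the sorted sequence, for the number `j` in integer array `2`. -/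
def growProg (e : RealExpr) : Prog :=
  .ite (.and (.not (.intLt (cellExpr lastExpr (.read 5 (var 1))) (costExpr (.read 5 (var 1)) (var 2))))
    (.realLt (.read 1 (var 1)) e)) (.setReal 1 (var 1) e) .skip

/-- Translate the solution of the last subproblem to ranges. -/
def rangeProg : Prog :=
  forLoop 1 (var 0) (forLoop 2 (var 0) (.seq
    (growProg (.sub (.read 2 (var 2)) (.read 2 (.read 5 (var 1)))))
    (growProg (.sub (.read 2 (.read 5 (var 1))) (.read 2 (var 2))))))

/-- `o` is the largest distance from `z` to those among the points `y 0, …, y (j - 1)` that satisfy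
`p`, or `0`. -/
def IsRange (y : ℕ → ℝ) (p : ℕ → Prop) (z : ℝ) (j : ℕ) (o : ℝ) : Prop :=
  (∀ k < j, p k → |y k - z| ≤ o) ∧ (o = 0 ∨ ∃ k < j, p k ∧ o = |y k - z|)

theorem IsRange.succ {y : ℕ → ℝ} {p : ℕ → Prop} [DecidablePred p] {z : ℝ} {j : ℕ} {o : ℝ}
    (h : IsRange y p z j o) : IsRange y p z (j + 1) (if p j then max o |y j - z| else o) := by
  obtain ⟨h1, h2⟩ := h
  have h2' : o = 0 ∨ ∃ k < j + 1, p k ∧ o = |y k - z| := h2.imp id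
    fun ⟨k, hk, h⟩ => ⟨k, by omega, h⟩
  split_ifs with hp
  · refine ⟨fun k hk hpk => ?_, ?_⟩
    · rcases (Nat.le_of_lt_succ hk).lt_or_eq with hk | rfl
      · exact (h1 k hk hpk).trans (le_max_left _ _)
      · exact le_max_right _ _
    · rcases max_choice o |y j - z| with h | h <;> rw [h]
      · exact h2'
      · exact .inr ⟨j, by omega, hp, rfl⟩
  · refine ⟨fun k hk hpk => ?_, h2'⟩
    rcases (Nat.le_of_lt_succ hk).lt_or_eq with hk | rfl
    · exact h1 k hk hpk
    · exact absurd hpk hp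

variable {L B n : ℕ} {m : Mem}

theorem runs_growProg (hB : WordSize L 100 B) (hm : m.Bounded L) {i j r : ℕ} {e : RealExpr} {v : ℝ}
    (he : e.Light 100) (hv : e.eval m = v) (h0 : m.int 0 0 = n) (h1 : m.int 1 0 = i)
    (h2 : m.int 2 0 = j) (h5 : m.int 5 i = r) :
    Runs B (growProg e) m (growProg e).cost fun m' => m'.int = m.int ∧
      (∀ b ≠ 1, m'.real b = m.real b) ∧ (∀ i' ≠ i, m'.real 1 i' = m.real 1 i') ∧
      m'.real 1 i = if m.int 6 (r * n + j) ≤ m.int 8 (((4 * (n - 1) + 3) * n + 0 + 1) * n + r) then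
        max (m.real 1 i) v else m.real 1 i := by
  have hlight : (Test.and (.not (.intLt (cellExpr lastExpr (.read 5 (var 1)))
      (costExpr (.read 5 (var 1)) (var 2)))) (.realLt (.read 1 (var 1)) e)).Light 100 :=
    ⟨by simp [Test.Light, IntExpr.weight, cellExpr, lastExpr, idExpr, costExpr],
      by simp [RealExpr.Light, IntExpr.weight], he⟩
  have hholds : (Test.and (.not (.intLt (cellExpr lastExpr (.read 5 (var 1)))
      (costExpr (.read 5 (var 1)) (var 2)))) (.realLt (.read 1 (var 1)) e)).Holds m ↔
      m.int 6 (r * n + j) ≤ m.int 8 (((4 * (n - 1) + 3) * n + 0 + 1) * n + r) ∧ m.real 1 i < v := by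
    simp only [Test.Holds, IntExpr.eval, RealExpr.eval, cellExpr, lastExpr, idExpr, costExpr, h0, h1,
      h2, h5, hv, not_lt]
  refine (Runs.ite hB hm hlight (fun hb => ?_) (fun hb => Runs.skip ?_)).mono le_rfl fun _ h => h
  · rw [hholds] at hb
    refine Runs.setReal hB hm (by simp [IntExpr.weight]) he ?_
    simp only [IntExpr.eval, h1, hv]
    refine ⟨rfl, fun b hb => Mem.setReal_real_of_ne _ _ _ hb, fun i' hi' => ?_, ?_⟩
    · rw [Mem.setReal_real, if_neg (by tauto)]
    · rw [Mem.setReal_real, if_pos ⟨rfl, rfl⟩, if_pos hb.1, max_eq_right hb.2.le]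
  · rw [hholds] at hb
    refine ⟨rfl, fun _ _ => rfl, fun _ _ => rfl, ?_⟩
    split_ifs with h
    · exact (max_eq_left (not_lt.1 fun h' => hb ⟨h, h'⟩)).symm
    · rfl

theorem runs_rangeProg (hB : WordSize L 100 B) (hm : m.Bounded L) (hn : m.int 0 0 = n)
    (hz : ∀ i, m.real 1 i = 0) :
    Runs B rangeProg m (n * (n * 200 + 200) + 200) fun m' => ∀ i < n,
      IsRange (m.real 2) (fun j => m.int 6 (m.int 5 i * n + j) ≤
        m.int 8 (((4 * (n - 1) + 3) * n + 0 + 1) * n + m.int 5 i)) (m.real 2 (m.int 5 i)) n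
        (m'.real 1 i) := by
  have hnL : n ≤ L := hn ▸ hm 0 0
  set p : ℕ → ℕ → Prop := fun i j => m.int 6 (m.int 5 i * n + j) ≤
        m.int 8 (((4 * (n - 1) + 3) * n + 0 + 1) * n + m.int 5 i) with hp
  have hcost : ∀ e : RealExpr, e.cost = 8 → (growProg e).cost ≤ 80 := fun e he => by
    simp [growProg, Prog.cost, Test.cost, IntExpr.cost, RealExpr.cost, cellExpr, costExpr, lastExpr,
      idExpr, he]
  refine (Runs.forLoop hB (by norm_num) hm (N := n) (T := n * 180 + 20)
    (fun i m' => m'.int 1 0 = i ∧ m'.Bounded L ∧ (∀ b, b ≠ 1 → b ≠ 2 → m'.int b = m.int b) ∧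
      (∀ b ≠ 1, m'.real b = m.real b) ∧
      (∀ i' < i, IsRange (m.real 2) (p i') (m.real 2 (m.int 5 i')) n (m'.real 1 i')) ∧
      ∀ i' ≥ i, m'.real 1 i' = 0)
    (by simp [IntExpr.weight]) ?_ ?_ ?_ ?_).mono (by simp only [IntExpr.cost]; ring_nf; omega) fun _ h => h
  · rintro k m' ⟨h1, h2, h3, -⟩
    exact ⟨h1, h2, by simp [IntExpr.eval, h3 0, hn]⟩
  · exact ⟨Mem.setInt_int_self .., hm.setInt (Nat.zero_le _),
      fun b h1 _ => Mem.setInt_int_of_ne _ _ _ h1, fun _ _ => rfl, by simp, fun i' _ => hz i'⟩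
  · rintro i hi m₁ ⟨h1, h2, h3, h4, h5, h6⟩
    refine (Runs.forLoop hB (by norm_num) h2 (N := n) (T := 160)
      (fun j m' => m'.int 2 0 = j ∧ m'.Bounded L ∧ m'.int 1 0 = i ∧
        (∀ b, b ≠ 1 → b ≠ 2 → m'.int b = m.int b) ∧ (∀ b ≠ 1, m'.real b = m.real b) ∧
        IsRange (m.real 2) (p i) (m.real 2 (m.int 5 i)) j (m'.real 1 i) ∧
        ∀ i' ≠ i, m'.real 1 i' = m₁.real 1 i')
      (by simp [IntExpr.weight]) ?_ ?_ ?_ ?_).mono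
        (by simp only [IntExpr.cost]; ring_nf; omega) fun _ h => h
    · rintro k m' ⟨h1, h2, -, h3, -⟩
      exact ⟨h1, h2, by simp [IntExpr.eval, h3 0, hn]⟩
    · refine ⟨Mem.setInt_int_self .., h2.setInt (Nat.zero_le _), by simp [Mem.setInt_int, h1],
        fun b b1 b2 => ?_, h4, ⟨fun k hk => absurd hk (Nat.not_lt_zero k), .inl (h6 i le_rfl)⟩,
        fun _ _ => rfl⟩
      rw [Mem.setInt_int_of_ne _ _ _ b2, h3 b b1 b2]
    · rintro j hj m₂ ⟨g1, g2, g3, g4, g5, g6, g7⟩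
      have hv₁ : ∀ m' : Mem, m'.int = m₂.int → (∀ b ≠ 1, m'.real b = m₂.real b) →
          (RealExpr.sub (.read 2 (var 2)) (.read 2 (.read 5 (var 1)))).eval m' =
            m.real 2 j - m.real 2 (m.int 5 i) := fun m' hi hr => by
        simp [RealExpr.eval, IntExpr.eval, hi, hr 2, g1, g3, g4 5, g5 2]
      have hv₂ : ∀ m' : Mem, m'.int = m₂.int → (∀ b ≠ 1, m'.real b = m₂.real b) →
          (RealExpr.sub (.read 2 (.read 5 (var 1))) (.read 2 (var 2))).eval m' =
            m.real 2 (m.int 5 i) - m.real 2 j := fun m' hi hr => by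
        simp [RealExpr.eval, IntExpr.eval, hi, hr 2, g1, g3, g4 5, g5 2]
      have h50 : m₂.int 5 i = m.int 5 i := by rw [g4 5 (by norm_num) (by norm_num)]
      have h00 : m₂.int 0 0 = n := by rw [g4 0 (by norm_num) (by norm_num), hn]
      refine (Runs.seq (T₂ := 80) ((runs_growProg hB g2
        (by simp [RealExpr.Light, IntExpr.weight]) (hv₁ m₂ rfl fun _ _ => rfl) h00 g3 g1 h50).mono
        (hcost _ rfl) ?_)).mono le_rfl fun _ h => h
      rintro m₃ ⟨k1, k2, k3, k4⟩
      have hb₃ : m₃.Bounded L := fun a b => by rw [k1]; exact g2 a b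
      refine (runs_growProg hB hb₃ (by simp [RealExpr.Light, IntExpr.weight]) (hv₂ m₃ k1 k2)
        (by rw [k1, h00]) (by rw [k1, g3]) (by rw [k1, g1]) (by rw [k1, h50])).mono (hcost _ rfl) ?_
      rintro m₄ ⟨l1, l2, l3, l4⟩
      have hi₄ : m₄.int = m₂.int := l1.trans k1
      -- Growing to a difference and then to its negative realizes the absolute value with
      -- comparisons only.
      have hval : m₄.real 1 i = if p i j then
          max (m₂.real 1 i) |m.real 2 j - m.real 2 (m.int 5 i)| else m₂.real 1 i := by
        rw [l4, k4, k1, g4 6 (by norm_num) (by norm_num), g4 8 (by norm_num) (by norm_num)]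
        by_cases h : p i j
        · rw [if_pos h, if_pos h, if_pos h, max_assoc, abs_eq_max_neg, neg_sub]
        · rw [if_neg h, if_neg h, if_neg h]
      have hb₄ : m₄.Bounded L := fun a b => by rw [hi₄]; exact g2 a b
      refine ⟨by rw [hi₄, g1], hb₄, Mem.setInt_int_self .., hb₄.setInt (by omega),
        by simp [Mem.setInt_int, hi₄, g3], fun b b1 b2 => ?_, fun b hb => ?_, ?_, fun i' hi' => ?_⟩
      · rw [Mem.setInt_int_of_ne _ _ _ b2, hi₄, g4 b b1 b2]
      · rw [Mem.setInt_real, l2 b hb, k2 b hb, g5 b hb]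
      · rw [Mem.setInt_real, hval]
        exact g6.succ
      · rw [Mem.setInt_real, l3 i' hi', k3 i' hi', g7 i' hi']
    · rintro m' ⟨g1, g2, g3, g4, g5, g6, g7⟩
      refine ⟨g3, g2, Mem.setInt_int_self .., g2.setInt (by omega), fun b b1 b2 => ?_, g5,
        fun i' hi' => ?_, fun i' hi' => ?_⟩
      · rw [Mem.setInt_int_of_ne _ _ _ b1, g4 b b1 b2]
      · rcases (Nat.le_of_lt_succ hi').lt_or_eq with h | rfl
        · rw [Mem.setInt_real, g7 i' h.ne]
          exact h5 i' h
        · exact g6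
      · rw [Mem.setInt_real, g7 i' (by omega), h6 i' (by omega)]
  · rintro m' ⟨-, -, -, -, h5, -⟩
    exact h5

/-! ### The complete algorithm -/

/-- The complete algorithm. -/
def optimalRangeProg : Prog := .seq sortProg (.seq costProg (.seq tableProg rangeProg))

theorem runs_optimalRangeProg (n : ℕ) (x : Fin n → ℝ) (hx : Function.Injective x) :
    Runs ((n + 2) ^ 401) optimalRangeProg (inputMem n x) ((8 * tableConst + 2000) * (n + 1) ^ 3)
      fun m => ∃ ρ : RangeAssignment (Fin n), Outputs m n (fun i => (ρ i : ℝ)) ∧ IsOptimal x ρ := by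
  -- `L` bounds every cell, including the subproblem numbers up to `4 * n * n` and the infinite cost
  -- `(n + 1) * (n + 1)`. Expressions have weight at most `100`, and `L ^ 100 = (n + 2) ^ 400` is
  -- below the word bound.
  set L := (n + 2) ^ 4 with hLdef
  have hB : WordSize L 100 ((n + 2) ^ 401) := by
    refine ⟨?_, ?_⟩
    · exact (show 2 ≤ n + 2 by omega).trans (Nat.le_self_pow (by norm_num) _)
    · rw [hLdef, ← pow_mul]
      exact pow_lt_pow_right₀ (by omega) (by norm_num)
  have hL : 4 * (n * n) + 4 * n + 4 ≤ L := by
    have h1 : 4 * (n + 2) ^ 2 ≤ (n + 2) ^ 2 * (n + 2) ^ 2 :=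
      Nat.mul_le_mul_right _ (Nat.pow_le_pow_left (show 2 ≤ n + 2 by omega) 2)
    have h2 : L = (n + 2) ^ 2 * (n + 2) ^ 2 := by rw [hLdef]; ring
    have h3 : 4 * (n + 2) ^ 2 = 4 * (n * n) + 16 * n + 16 := by ring
    omega
  set m₀ := inputMem n x with hm₀
  have h00 : m₀.int 0 0 = n := rfl
  have hzero : ∀ a, a ≠ 0 → ∀ i, m₀.int a i = 0 := fun a ha i => if_neg fun h => ha h.1
  have hb₀ : m₀.Bounded L := fun a i => by
    simp only [hm₀, inputMem]
    split_ifs <;> omega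
  have hX : ∀ i : Fin n, m₀.real 0 i = x i := fun i => dif_pos ⟨rfl, i.2⟩
  have hX1 : ∀ i, m₀.real 1 i = 0 := fun i => by simp [hm₀, inputMem]
  have hinj : ∀ i < n, ∀ j < n, i ≠ j → m₀.real 0 i < m₀.real 0 j ∨ m₀.real 0 j < m₀.real 0 i := by
    intro i hi j hj hij
    rw [hX ⟨i, hi⟩, hX ⟨j, hj⟩]
    exact lt_or_gt_of_ne fun h => hij (Fin.mk.inj_iff.1 (hx h))
  have hrank : ∀ i < n, ∀ j < n, rank n (m₀.real 0) i < rank n (m₀.real 0) j →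
      m₀.real 0 i < m₀.real 0 j := by
    intro i hi j hj h
    rcases hinj i hi j hj (by rintro rfl; exact h.ne rfl) with h' | h'
    · exact h'
    · exact absurd (rank_lt_rank hj h') h.not_gt
  have hinj' : Function.Injective fun i : Fin n => (⟨rank n (m₀.real 0) i, rank_lt i.2⟩ : Fin n) := by
    intro i j hij
    by_contra hne
    have hr : rank n (m₀.real 0) i = rank n (m₀.real 0) j := Fin.mk.inj_iff.1 hij
    rcases hinj i i.2 j j.2 fun h => hne (Fin.ext h) with h' | h'
    · exact (rank_lt_rank i.2 h').ne hr
    · exact (rank_lt_rank j.2 h').ne' hr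
  set e : Fin n ≃ Fin n := Equiv.ofBijective _ (Finite.injective_iff_bijective.1 hinj') with he
  have hev : ∀ i : Fin n, ((e i : Fin n) : ℕ) = rank n (m₀.real 0) i := fun i => rfl
  refine (Runs.seq ((runs_sortProg hB hb₀ h00 (fun i _ => hzero 5 (by norm_num) i) hinj).mono le_rfl
    ?_)).mono (T := (n * (n * 31 + 34) + 12) + ((n * (n * (n * 83 + 24) + 24) + 12) +
      ((n * (4 * (n * (n * tableConst + tableConst + 20) + 100) + 100) + 100) +
        (n * (n * 200 + 200) + 200)))) ?_ fun _ h => h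
  swap
  · ring_nf
    omega
  rintro m₁ ⟨b₁, i₁, r₁, x₁, y₁⟩
  have hn₁ : m₁.int 0 0 = n := by rw [i₁ 0 (by norm_num) (by norm_num) (by norm_num), h00]
  refine Runs.seq ((runs_costProg hB b₁ hn₁ fun i => ?_).mono le_rfl ?_)
  · rw [i₁ 6 (by norm_num) (by norm_num) (by norm_num), hzero 6 (by norm_num)]
  rintro m₂ ⟨b₂, i₂, c₂, x₂⟩
  have hi₂ : ∀ b, b = 0 ∨ b = 7 ∨ b = 8 → m₂.int b = m₀.int b := fun b hb => by
    rw [i₂ b (by omega) (by omega) (by omega) (by omega), i₁ b (by omega) (by omega) (by omega)]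
  refine Runs.seq ((runs_tableProg hB b₂ (n := n) (by rw [hi₂ 0 (by simp), h00]) hL c₂ ?_ ?_).mono
    le_rfl ?_)
  · rw [hi₂ 7 (by simp), hzero 7 (by norm_num)]
  · intro i _
    rw [hi₂ 8 (by simp), hzero 8 (by norm_num)]
  intro m₃ h₃
  refine (runs_rangeProg hB h₃.bounded (n := n) ?_ fun i => ?_).mono le_rfl ?_
  · rw [h₃.int_eq 0 (by simp), hi₂ 0 (by simp), h00]
  · rw [h₃.real_eq, x₂, x₁ 1 (by norm_num), hX1]
  intro m₄ h₄
  have hr : m₃.real 2 = m₁.real 2 := by rw [h₃.real_eq, x₂]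
  have h5 : ∀ i : Fin n, m₃.int 5 i = e i := fun i => by
    rw [h₃.int_eq 5 (by simp), i₂ 5 (by norm_num) (by norm_num) (by norm_num) (by norm_num), r₁ i i.2,
      hev]
  have h6 : ∀ i : Fin n, ∀ j < n, m₃.int 6 (e i * n + j) = coverCount n (m₁.real 2) (e i) j :=
    fun i j hj => by rw [h₃.int_eq 6 (by simp), c₂ _ (e i).2 j hj]
  rw [hr] at h₄
  have hnonneg : ∀ i : Fin n, 0 ≤ m₄.real 1 i := fun i => by
    rcases (h₄ i i.2).2 with h | ⟨k, -, -, h⟩ <;> rw [h]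
    exact abs_nonneg _
  refine ⟨fun i => ⟨m₄.real 1 i, hnonneg i⟩, fun i => rfl, ?_⟩
  have hy : ∀ i, m₁.real 2 (e i) = x i := fun i => by rw [hev, y₁ i i.2, hX]
  have hymono : ∀ i j, i < j → j < n → m₁.real 2 i < m₁.real 2 j := by
    intro i j hij hj
    obtain ⟨u, hu⟩ := e.surjective ⟨i, hij.trans hj⟩
    obtain ⟨v, hv⟩ := e.surjective ⟨j, hj⟩
    have hu' : rank n (m₀.real 0) u = i := Fin.ext_iff.1 hu
    have hv' : rank n (m₀.real 0) v = j := Fin.ext_iff.1 hv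
    rw [← hu', ← hv', y₁ u u.2, y₁ v v.2]
    exact hrank u u.2 v v.2 (by omega)
  have hopt : Feasible n (coverCount n (m₁.real 2))
        (fun i => m₃.int 8 (((4 * (n - 1) + 3) * n + 0 + 1) * n + i)) ∧
      ∀ κ, Feasible n (coverCount n (m₁.real 2)) κ →
        ∑ i ∈ Finset.range n, m₃.int 8 (((4 * (n - 1) + 3) * n + 0 + 1) * n + i) ≤
          ∑ i ∈ Finset.range n, κ i := by
    -- Without points there is no last subproblem, but feasibility and minimality are vacuous.
    rcases Nat.eq_zero_or_pos n with hn | hn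
    · subst hn
      exact ⟨fun u v hu => absurd hu (Nat.not_lt_zero u), fun κ _ => by simp⟩
    · have hc := h₃.isTable.optimal (lineCost_coverCount hymono) hn
        (fun i _ j _ => coverCount_le ..) (by ring_nf; omega)
      simpa [State.id] using hc
  refine isOptimal_of_sorted hx e hy hopt.1 hopt.2 (fun i j hj hle => ?_) fun i => ?_
  · have := (h₄ i i.2).1 j hj
    simp only [h5, h6 i j hj] at this
    exact this hle
  · refine (h₄ i i.2).2.imp id ?_
    rintro ⟨j, hj, hle, heq⟩
    simp only [h5, h6 i j hj] at hle heq
    exact ⟨j, hj, hle, heq⟩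

end RealRAM

/-- There are a single program, a time bound `T n = O(n ^ 3)` and an exponent `d` such that, for
every `n` and every set of `n` points on the real line, given as an array of coordinates in
arbitrary order, the program, run with machine integers below `(n + 2) ^ d`, that is, with words
of `O(log n)` bits, stops after at most `T n` steps and outputs an optimal range assignment. -/
theorem mainTheorem1 :
    ∃ (P : RealRAM.Prog) (T : ℕ → ℕ) (d : ℕ),
      (fun n : ℕ => (T n : ℝ)) =O[Filter.atTop] (fun n : ℕ => (n : ℝ) ^ 3) ∧
      ∀ (n : ℕ) (x : Fin n → ℝ), Function.Injective x →
        ∃ (t : ℕ) (m : RealRAM.Mem) (ρ : Interference.RangeAssignment (Fin n)),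
          RealRAM.Exec ((n + 2) ^ d) P (RealRAM.inputMem n x) t m ∧
          t ≤ T n ∧
          RealRAM.Outputs m n (fun i => (ρ i : ℝ)) ∧
          Interference.IsOptimal x ρ := by
  refine ⟨RealRAM.optimalRangeProg, fun n => (8 * RealRAM.tableConst + 2000) * (n + 1) ^ 3, 401,
    ?_, fun n x hx => ?_⟩
  -- The factor `8` comes from `n + 1 ≤ 2 * n` for `n ≥ 1`.
  · refine Asymptotics.IsBigO.of_bound ((8 * RealRAM.tableConst + 2000) * 8) ?_
    filter_upwards [Filter.eventually_ge_atTop 1] with n hn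
    have h1 : (1 : ℝ) ≤ n := by exact_mod_cast hn
    have h2 : ((n : ℝ) + 1) ^ 3 ≤ (2 * n) ^ 3 := by gcongr; linarith
    rw [Real.norm_of_nonneg (by positivity), Real.norm_of_nonneg (by positivity)]
    push_cast
    calc (8 * (RealRAM.tableConst : ℝ) + 2000) * (n + 1) ^ 3
        ≤ (8 * RealRAM.tableConst + 2000) * (2 * n) ^ 3 := by gcongr
      _ = _ := by ring
  · obtain ⟨t, m, h1, h2, ρ, h3, h4⟩ := RealRAM.runs_optimalRangeProg n x hx
    exact ⟨t, m, ρ, h1, h2, h3, h4⟩
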